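/- **Setting.** Fix $m\ge 1$. Let $\mathfrak G$ be the set of oriented graphs on the vertex set $\{1,\dots,m\}$ (loops and multiple edges allowed) with at least one edge starting and at least one edge ending at every vertex, equipped with a linear (Vershik) order on the edges starting at each vertex. For an edge $e$ let $I(e),F(e)$ be its initial and final vertices. For $\Gamma\in\mathfrak G$ let $A(\Gamma)_{ij}$ be the number of edges from $i$ to $j$, let $\zeta(\Gamma)$ be the substitution sending $b$ to the word of final vertices of the edges starting at $b$, listed in order, and let $\mathsf S_{\zeta(\Gamma)}=A(\Gamma)^t$ be its substitution matrix. Concatenated graphs satisfy $\zeta(\Gamma\Delta)=\zeta(\Gamma)\circ\zeta(\Delta)$. Let $\Omega=\mathfrak G^{\mathbb Z}$ with the left shift $\sigma$, let $\mathbf q\in\mathfrak G$, $\zeta=\zeta(\mathbf q)$, $Q=\mathsf S_\zeta$, and let $\mathbb P$ be an ergodic $\sigma$-invariant probability measure on $\Omega$ such that almost surely every $\mathbf a_n$ is a concatenation $\mathbf q\,\mathbf p_n\,\mathbf q$ with $\mathbf p_n\in\mathfrak G$. Let $\|\cdot\|$ be the Euclidean operator norm and $\mathbb A(n,\mathbf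 a)=A(\mathbf a_n)\cdots A(\mathbf a_1)$ for $n\ge 0$. Assume: * (C1) for some word $\mathbf w=w_1\dots w_k$ in $\mathfrak G$, $k\ge1$, the matrix $A(w_k)\cdots A(w_1)$ is strictly positive and $\mathbb P\{\mathbf a:\mathbf a_{-k+1}\dots\mathbf a_0=\mathbf a_1\dots\mathbf a_k=\mathbf w\}>0$; * (C2) almost surely all $A(\mathbf a_n)$ are invertible; * (C3) $\log(1+\|A(\mathbf a_1)\|)$ and $\log(1+\|A(\mathbf a_1)^{-1}\|)$ are $\mathbb P$-integrable; * (a′) the Lyapunov spectrum of $\mathbb A$ is $\theta_1>\theta_2>0>\theta_3>\dots$, with $\theta_1,\theta_2$ simple; * (b′) all entries of $Q$ are strictly positive; * (c′) there are good return words $u_1,\dots,u_m$ for $\zeta$ whose population vectors (the $j$-th entry counts the letters $j$) form a basis of $\mathbb R^m$; here $v$ is a *good return word* for $\zeta$, $v\in GR(\zeta)$, if $v$ starts with some letter $c$ and $vc$ occurs in $\zeta(b)$ for every letter $b$; * (d′) there are $\varepsilon>0$ and $1<C'<\infty$ such that the conditional expectation of $\|A(\mathbf a_0)\|^\varepsilon$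 given $(\mathbf a_1,\mathbf a_2,\dots)$ is at most $C'$ almost surely. For $\mathbf a\in\Omega$ let $X_+(\mathbf a)$ be the set of sequences $\mathfrak e=(\mathfrak e_n)_{n\ge1}$ with $\mathfrak e_n$ an edge of $\mathbf a_n$ and $F(\mathfrak e_{n+1})=I(\mathfrak e_n)$. Two such paths are comparable if they agree from some index on, and are then ordered by the last edges at which they differ. The Bratteli–Vershik map $\mathfrak T$ sends every non-maximal path (one with some non-maximal edge) to its immediate successor. For $\vec s\in\mathbb R^m$ with $s_i>0$ and $\sum_i s_i=1$ let $(\mathfrak X^{\vec s},h_\tau)$ be the suspension flow over $(X_+(\mathbf a),\mathfrak T)$ under the roof function $\mathfrak e\mapsto s_{F(\mathfrak e_1)}$; its points are the pairs $(\mathfrak e,t)$ with $0\le t<s_{F(\mathfrak e_1)}$. A *cylindrical function of level $\ell$* is a function $f:\mathfrak X^{\vec s}\to\mathbb C$ such that $f(\mathfrak e,t)$ depends only on $\mathfrak e_1,\dots,\mathfrak e_\ell$ and, measurably, on $t$; $\|f\|_\infty$ is its sup norm. Put $$S_R^{(\mathfrak e,t)}(f,\omega)=\int_0^R e^{-2\pi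 i\omega\tau}f(h_\tau(\mathfrak e,t))\,d\tau .$$ Let $\zeta^{[k]}=\zeta(\mathbf a_1)\circ\dots\circ\zeta(\mathbf a_k)$; let $|v|_{\vec s}=\sum_j s_j\cdot\#\{\text{letters } j \text{ in } v\}$; let $\|x\|_{\mathbb R/\mathbb Z}$ be the distance from $x$ to the nearest integer, and $$c_1=\Bigl(2m\cdot\max_{i,j}Q_{ij}\cdot\max_{i,j,k}\frac{Q_{ji}}{Q_{jk}}\Bigr)^{-1}.$$ **Proposition.** There is a constant $O_Q(1)>0$ depending only on $Q$ such that for all $\mathbf q$ and $\mathbb P$ as above the following holds for $\mathbb P$-a.e. $\mathbf a$. For every $\eta\in(0,1)$ there is $\ell_\eta=\ell_\eta(\mathbf a)\in\mathbb N$ such that for all $\ell\ge\ell_\eta$, all $\vec s$ with $s_i>0$ and $\sum_i s_i=1$, every bounded cylindrical function $f$ of level $\ell$, every $(\mathfrak e,t)\in\mathfrak X^{\vec s}$ whose forward orbit is defined (that is, no $\mathfrak T^n\mathfrak e$, $n\ge0$, is a maximal path), every $\omega\in\mathbb R$ and every $R\ge e^{8\theta_1\ell}$, $$|S_R^{(\mathfrak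 e,t)}(f,\omega)|\le O_Q(1)\,\|f\|_\infty\Bigl(R^{1/2}+R^{1+\eta}\prod_{\ell+1\le k<\frac{\log R}{4\theta_1}}\Bigl(1-c_1\max_{v\in GR(\zeta)}\bigl\|\omega\,|\zeta^{[k]}(v)|_{\vec s}\bigr\|_{\mathbb R/\mathbb Z}^2\Bigr)\Bigr).$$ -/

import Mathlib

open MeasureTheory Filter
open scoped Matrix

namespace RandomBV

/-! ### Words and substitutions on the alphabet `Fin m` -/

/-- A substitution acts on words by concatenation. -/
def applySubst {m : ℕ} (ζ : Fin m → List (Fin m)) (w : List (Fin m)) : List (Fin m) :=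
  w.flatMap ζ

/-- `v` is a good return word for `ζ`: it starts with some letter `c`, and the word `vc` occurs
in `ζ(b)` for every letter `b`. -/
def IsGoodReturnWord {m : ℕ} (ζ : Fin m → List (Fin m)) (v : List (Fin m)) : Prop :=
  ∃ c : Fin m, v.head? = some c ∧ ∀ b : Fin m, (v ++ [c]) <:+: ζ b

/-- The population vector of a word: its `j`-th entry is the number of `j`'s in the word. -/
def population {m : ℕ} (v : List (Fin m)) : Fin m → ℝ := fun j => (v.count j : ℝ)

/-- The tiling length `|v|_s = ⟨population v, s⟩`. -/
def tilingLength {m : ℕ} (s : Fin m → ℝ) (v : List (Fin m)) : ℝ := ∑ j, population v j * s j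

/-! ### Oriented graphs with a Vershik ordering -/

/-- An oriented graph on the vertex set `Fin m` (loops and multiple edges allowed) with an edge
starting at every vertex and an edge ending at every vertex, together with a linear order on the
set of edges starting at each vertex.  The edges starting at `i`, listed in increasing order, are
recorded through the list `out i` of their final vertices. -/
structure OrdGraph (m : ℕ) where
  out : Fin m → List (Fin m)
  out_ne_nil : ∀ i, out i ≠ []
  exists_into : ∀ j, ∃ i, j ∈ out i

namespace OrdGraph

variable {m : ℕ}

/-- An edge is an initial vertex `i` together with a position in the ordered list of edges
starting at `i`. -/
abbrev Edge (Γ : OrdGraph m) : Type := Σ i : Fin m, Fin (Γ.out i).length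

/-- Initial vertex `I(e)`. -/
def initial {Γ : OrdGraph m} (e : Γ.Edge) : Fin m := e.1

/-- Final vertex `F(e)`. -/
def final {Γ : OrdGraph m} (e : Γ.Edge) : Fin m := (Γ.out e.1).get e.2

/-- An edge is maximal if it is the last one among the edges with the same initial vertex. -/
def IsMaxEdge {Γ : OrdGraph m} (e : Γ.Edge) : Prop := (e.2 : ℕ) + 1 = (Γ.out e.1).length

/-- Vershik's order: two edges are comparable if they start at the same vertex. -/
def EdgeLT {Γ : OrdGraph m} (e e' : Γ.Edge) : Prop := e.1 = e'.1 ∧ (e.2 : ℕ) < (e'.2 : ℕ)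

/-- The substitution of an ordered graph: `ζ(b)` lists the final vertices of the edges starting
at `b`, in the Vershik order. -/
def subst (Γ : OrdGraph m) : Fin m → List (Fin m) := Γ.out

/-- The incidence matrix: `A i j` is the number of edges from `i` to `j`. -/
def incidence (Γ : OrdGraph m) : Matrix (Fin m) (Fin m) ℕ := Matrix.of fun i j => (Γ.out i).count j

/-- The substitution matrix: `S a b` is the number of `a`'s in `ζ(b)`. -/
def substMatrix (Γ : OrdGraph m) : Matrix (Fin m) (Fin m) ℕ :=
  Matrix.of fun a b => (Γ.subst b).count a

/-- The incidence matrix with real entries. -/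
def realIncidence (Γ : OrdGraph m) : Matrix (Fin m) (Fin m) ℝ := Γ.incidence.map (fun n => (n : ℝ))

/-- Concatenation (aggregation) of two ordered graphs.  Edges of `Γ.concat Δ` from `i` are the
pairs (an edge of `Δ` from `i`, followed by an edge of `Γ` from its final vertex), ordered first by
the edge of `Δ`.  Its substitution is the composition `ζ(Γ) ∘ ζ(Δ)`. -/
def concat (Γ Δ : OrdGraph m) : OrdGraph m where
  out i := applySubst Γ.subst (Δ.subst i)
  out_ne_nil i := by
    obtain ⟨j, hj⟩ := List.exists_mem_of_ne_nil _ (Δ.out_ne_nil i)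
    obtain ⟨k, hk⟩ := List.exists_mem_of_ne_nil _ (Γ.out_ne_nil j)
    exact List.ne_nil_of_mem (List.mem_flatMap.2 ⟨j, hj, hk⟩)
  exists_into k := by
    obtain ⟨j, hj⟩ := Γ.exists_into k
    obtain ⟨i, hi⟩ := Δ.exists_into j
    exact ⟨i, List.mem_flatMap.2 ⟨j, hi, hj⟩⟩

/-- The discrete σ-algebra on the (countable) set of ordered graphs. -/
instance : MeasurableSpace (OrdGraph m) := ⊤

end OrdGraph

/-! ### One-sided Markov compacta and the Bratteli-Vershik map

A one-sided sequence `Γ : ℕ → OrdGraph m` is indexed from `0`: the graph `Γ n` connects the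
vertices of level `n + 1` to the vertices of level `n`. -/

section Compactum

variable {m : ℕ}

/-- The one-sided Markov compactum: sequences of edges `e n ∈ Γ n` such that the final vertex of
`e (n + 1)` is the initial vertex of `e n`. -/
def PathSpace (Γ : ℕ → OrdGraph m) : Type :=
  {e : ∀ n, (Γ n).Edge // ∀ n, OrdGraph.final (e (n + 1)) = OrdGraph.initial (e n)}

/-- The vertex of level `0` through which a path goes. -/
def PathSpace.vertexZero {Γ : ℕ → OrdGraph m} (e : PathSpace Γ) : Fin m := OrdGraph.final (e.1 0)

/-- The partial order on paths induced by the Vershik ordering: two paths are comparable if they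
agree from some point on, and then the last edges at which they differ are compared. -/
def PathLT {Γ : ℕ → OrdGraph m} (e e' : PathSpace Γ) : Prop :=
  ∃ N, OrdGraph.EdgeLT (e.1 N) (e'.1 N) ∧ ∀ n, N < n → e.1 n = e'.1 n

/-- `e'` is the immediate successor of `e`. -/
def IsSuccPath {Γ : ℕ → OrdGraph m} (e e' : PathSpace Γ) : Prop :=
  PathLT e e' ∧ ∀ d, ¬ (PathLT e d ∧ PathLT d e')

/-- A maximal path: all its edges are maximal. -/
def IsMaxPath {Γ : ℕ → OrdGraph m} (e : PathSpace Γ) : Prop :=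
  ∀ n, OrdGraph.IsMaxEdge (e.1 n)

open Classical in
/-- The Bratteli-Vershik map, sending a path to its immediate successor (which exists, and is
unique, for every path that is not maximal).  The value at a path without successor is irrelevant:
the map is iterated only along orbits that avoid such paths. -/
noncomputable def bvMap {Γ : ℕ → OrdGraph m} (e : PathSpace Γ) : PathSpace Γ :=
  if h : ∃ e', IsSuccPath e e' then h.choose else e

/-- All the forward iterates of `e` under the Bratteli-Vershik map are defined: its forward orbit
does not hit a maximal path. -/
def HasForwardOrbit {Γ : ℕ → OrdGraph m} (e : PathSpace Γ) : Prop :=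
  ∀ n : ℕ, ¬ IsMaxPath (bvMap^[n] e)

/-! ### The suspension flow -/

/-- The piecewise constant roof function determined by the vector `s`. -/
def roof {Γ : ℕ → OrdGraph m} (s : Fin m → ℝ) (e : PathSpace Γ) : ℝ := s e.vertexZero

/-- The suspension space, represented by the fundamental domain `{(e, t) : 0 ≤ t < roof e}` for the
identification `(e, roof e) ∼ (bvMap e, 0)`. -/
def suspension (Γ : ℕ → OrdGraph m) (s : Fin m → ℝ) : Set (PathSpace Γ × ℝ) :=
  {p | 0 ≤ p.2 ∧ p.2 < roof s p.1}

/-- The time of the `n`-th return to the base, for a point starting at `(e, 0)`. -/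
noncomputable def returnTime {Γ : ℕ → OrdGraph m} (s : Fin m → ℝ) (e : PathSpace Γ) (n : ℕ) : ℝ :=
  ∑ j ∈ Finset.range n, roof s (bvMap^[j] e)

/-- The number of returns to the base up to time `u`, for a point starting at `(e, 0)`: the unique
`n` with `returnTime n ≤ u < returnTime (n + 1)`, when `u ≥ 0` and `s > 0`. -/
noncomputable def returnCount {Γ : ℕ → OrdGraph m} (s : Fin m → ℝ) (e : PathSpace Γ) (u : ℝ) : ℕ :=
  sInf {n : ℕ | u < returnTime s e (n + 1)}

/-- The suspension flow `h_τ`, for times `τ ≥ 0`. -/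
noncomputable def flow {Γ : ℕ → OrdGraph m} (s : Fin m → ℝ) (τ : ℝ) (p : PathSpace Γ × ℝ) :
    PathSpace Γ × ℝ :=
  (bvMap^[returnCount s p.1 (p.2 + τ)] p.1,
    p.2 + τ - returnTime s p.1 (returnCount s p.1 (p.2 + τ)))

/-- A cylindrical function of level `ℓ` on the suspension space: its value depends only on the
first `ℓ` edges of the path and on the height `t` (measurably on `t`).  Only the values on the
suspension space matter. -/
structure IsCylindrical {Γ : ℕ → OrdGraph m} (s : Fin m → ℝ) (ℓ : ℕ)
    (f : PathSpace Γ × ℝ → ℂ) : Prop where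
  depends : ∀ (e e' : PathSpace Γ) (t : ℝ), (e, t) ∈ suspension Γ s → (e', t) ∈ suspension Γ s →
    (∀ k < ℓ, e.1 k = e'.1 k) → f (e, t) = f (e', t)
  measurable : ∀ e : PathSpace Γ,
    AEStronglyMeasurable (fun t => f (e, t)) (volume.restrict (Set.Ico 0 (roof s e)))

/-- Boundedness on the suspension space. -/
def IsBoundedOn {Γ : ℕ → OrdGraph m} (s : Fin m → ℝ) (f : PathSpace Γ × ℝ → ℂ) : Prop :=
  ∃ K : ℝ, ∀ p ∈ suspension Γ s, ‖f p‖ ≤ K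

/-- The sup norm `‖f‖_∞` over the suspension space (for bounded `f`). -/
noncomputable def supNorm {Γ : ℕ → OrdGraph m} (s : Fin m → ℝ) (f : PathSpace Γ × ℝ → ℂ) : ℝ :=
  ⨆ p : suspension Γ s, ‖f p‖

/-- The twisted Birkhoff integral `S_R^{(p)}(f, ω) = ∫_0^R e^{-2πiωτ} f(h_τ p) dτ`. -/
noncomputable def twistedIntegral {Γ : ℕ → OrdGraph m} (s : Fin m → ℝ)
    (f : PathSpace Γ × ℝ → ℂ) (p : PathSpace Γ × ℝ) (ω R : ℝ) : ℂ :=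
  ∫ τ in (0 : ℝ)..R, Complex.exp (-2 * Real.pi * Complex.I * ω * τ) * f (flow s τ p)

/-- `ζ^{[n]} = ζ_1 ∘ ⋯ ∘ ζ_n` acting on words, where `ζ_{j+1}` is the substitution of `Γ j`;
`ζ^{[0]}` is the identity. -/
def iterSubst (Γ : ℕ → OrdGraph m) : ℕ → List (Fin m) → List (Fin m)
  | 0, w => w
  | n + 1, w => iterSubst Γ n (applySubst (Γ n).subst w)

end Compactum

/-! ### Two-sided random sequences of graphs -/

section Random

variable {m : ℕ}

/-- The left shift on two-sided sequences. -/
def shift (a : ℤ → OrdGraph m) : ℤ → OrdGraph m := fun n => a (n + 1)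

/-- The future `a⁺ = a_1 a_2 …` of a two-sided sequence. -/
def future (a : ℤ → OrdGraph m) : ℕ → OrdGraph m := fun n => a ((n : ℤ) + 1)

/-- The σ-algebra generated by the future. -/
abbrev futureSigma (m : ℕ) : MeasurableSpace (ℤ → OrdGraph m) :=
  MeasurableSpace.comap future inferInstance

/-- The Euclidean operator norm of a matrix. -/
noncomputable def opNorm (A : Matrix (Fin m) (Fin m) ℝ) : ℝ :=
  ‖Matrix.toEuclideanCLM (n := Fin m) (𝕜 := ℝ) A‖

/-- `A(w) = A(w_k) ⋯ A(w_1)` for a word `w = w_1 … w_k` of graphs. -/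
def wordMatrix : List (OrdGraph m) → Matrix (Fin m) (Fin m) ℕ
  | [] => 1
  | Γ :: w => wordMatrix w * Γ.incidence

/-- The two-sided cylinder `[w.w]`: sequences with `a_{-k+1} … a_0 = a_1 … a_k = w`. -/
def doubleCylinder (w : List (OrdGraph m)) : Set (ℤ → OrdGraph m) :=
  {a | ∀ i : Fin w.length,
    a ((i : ℤ) + 1) = w.get i ∧ a (-(w.length : ℤ) + 1 + (i : ℤ)) = w.get i}

/-- The renormalization cocycle `𝔸(n, a) = A(a_n) ⋯ A(a_1)`, `n ≥ 0`. -/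
def cocycle (a : ℤ → OrdGraph m) : ℕ → Matrix (Fin m) (Fin m) ℝ
  | 0 => 1
  | n + 1 => (a ((n : ℤ) + 1)).realIncidence * cocycle a n

/-- The Lyapunov exponent of a vector: `χ(a, v) = limsup (1/n) log ‖𝔸(n, a) v‖`, with the usual
convention `χ(a, 0) = -∞`. -/
noncomputable def lyapunovExponent (a : ℤ → OrdGraph m) (v : Fin m → ℝ) : EReal :=
  limsup (fun n : ℕ => ENNReal.log ‖WithLp.toLp 2 (cocycle a n *ᵥ v)‖ₑ / ((n : ℝ) : EReal)) atTop

/-- For almost every `a` the Lyapunov spectrum is `θ₁ > θ₂ > 0 > θ₃ > …`, the exponents `θ₁` and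
`θ₂` being simple: in the filtration of `ℝ^m` by the subspaces `{v | χ(a, v) < c}`, the exponents
`θ₁` and `θ₂` correspond to jumps of dimension one, and all other exponents are negative. -/
def TwoSimplePositiveExponents (P : Measure (ℤ → OrdGraph m)) (θ₁ θ₂ : ℝ) : Prop :=
  θ₂ < θ₁ ∧ 0 < θ₂ ∧ ∀ᵐ a ∂P,
    (∀ v, lyapunovExponent a v ≤ (θ₁ : EReal)) ∧
    Set.finrank ℝ {v | lyapunovExponent a v < (θ₁ : EReal)} + 1 = m ∧
    (∀ v, lyapunovExponent a v < (θ₁ : EReal) → lyapunovExponent a v ≤ (θ₂ : EReal)) ∧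
    Set.finrank ℝ {v | lyapunovExponent a v < (θ₂ : EReal)} + 2 = m ∧
    (∀ v, lyapunovExponent a v < (θ₂ : EReal) → lyapunovExponent a v < 0)

/-- The conditions on a random sequence of ordered graphs, with law `P`, all of whose terms are of
the form `q p_n q`, where `q` is a fixed ordered graph. -/
structure Conditions (q : OrdGraph m) (P : Measure (ℤ → OrdGraph m)) (θ₁ θ₂ : ℝ) : Prop where
  isProbability : IsProbabilityMeasure P
  ergodic : Ergodic shift P
  /-- Almost surely, every `a_n` is the concatenation `q p_n q` for some ordered graph `p_n`. -/
  form : ∀ᵐ a ∂P, ∀ n : ℤ, ∃ p : OrdGraph m, a n = (q.concat p).concat q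
  /-- (C1) -/
  exists_word : ∃ w : List (OrdGraph m), w ≠ [] ∧ (∀ i j, 0 < wordMatrix w i j) ∧
    0 < P (doubleCylinder w)
  /-- (C2) -/
  invertible : ∀ᵐ a ∂P, ∀ n : ℤ, IsUnit (a n).realIncidence
  /-- (C3) -/
  log_integrable : Integrable (fun a => Real.log (1 + opNorm (a 1).realIncidence)) P
  log_inv_integrable : Integrable (fun a => Real.log (1 + opNorm (a 1).realIncidence⁻¹)) P
  /-- (a') -/
  exponents : TwoSimplePositiveExponents P θ₁ θ₂
  /-- (b') -/
  pos : ∀ i j, 0 < q.substMatrix i j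
  /-- (c') -/
  good_words : ∃ u : Fin m → List (Fin m), (∀ j, IsGoodReturnWord q.subst (u j)) ∧
    LinearIndependent ℝ (fun j => population (u j)) ∧
    Submodule.span ℝ (Set.range fun j => population (u j)) = ⊤
  /-- (d'): the conditional expectation of `‖A(a_0)‖^ε` given the future is bounded. -/
  conditional_moment : ∃ ε C : ℝ, 0 < ε ∧ 1 < C ∧
    Integrable (fun a => opNorm (a 0).realIncidence ^ ε) P ∧
    P[fun a => opNorm (a 0).realIncidence ^ ε | futureSigma m] ≤ᵐ[P] fun _ => C

end Random

/-! ### The quantities in the estimate -/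

section Estimate

variable {m : ℕ}

/-- `col(A) = max_{i,j,k} A_{ij} / A_{kj}`. -/
noncomputable def col (A : Matrix (Fin m) (Fin m) ℕ) : ℝ :=
  ⨆ x : Fin m × Fin m × Fin m, (A x.1 x.2.1 : ℝ) / (A x.2.2 x.2.1 : ℝ)

/-- The largest entry of a matrix. -/
noncomputable def maxEntry (A : Matrix (Fin m) (Fin m) ℕ) : ℝ :=
  ⨆ x : Fin m × Fin m, (A x.1 x.2 : ℝ)

/-- The constant `c₁ = (2 m · max_{i,j} Q_{ij} · col(Qᵗ))⁻¹`. -/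
noncomputable def c₁ (Q : Matrix (Fin m) (Fin m) ℕ) : ℝ := (2 * m * maxEntry Q * col Qᵀ)⁻¹

/-- Distance from a real number to the nearest integer. -/
noncomputable def distInt (x : ℝ) : ℝ := |x - round x|

/-- `max_v ‖ω |ζ^{[k]}(v)|_s‖²_{ℝ/ℤ}` over the good return words `v` of `ζ` (the set of good return
words is finite, and it is nonempty in our setting). -/
noncomputable def maxReturnDist (ζ : Fin m → List (Fin m)) (Γ : ℕ → OrdGraph m) (s : Fin m → ℝ)
    (ω : ℝ) (k : ℕ) : ℝ :=
  ⨆ v : {v : List (Fin m) // IsGoodReturnWord ζ v},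
    distInt (ω * tilingLength s (iterSubst Γ k v)) ^ 2

/-- `∏ (1 - c₁ max_v ‖ω |ζ^{[k]}(v)|_s‖²)` over the integers `k` with `ℓ + 1 ≤ k < x`. -/
noncomputable def dampingProduct (q : OrdGraph m) (Γ : ℕ → OrdGraph m) (s : Fin m → ℝ)
    (ω : ℝ) (ℓ : ℕ) (x : ℝ) : ℝ :=
  ∏ k ∈ Finset.Ico (ℓ + 1) ⌈x⌉₊, (1 - c₁ q.substMatrix * maxReturnDist q.subst Γ s ω k)

end Estimate

end RandomBV

open RandomBV

/-!
The forward orbit of a path under the Bratteli-Vershik map runs through towers of level `n`: the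
orbit of the bottom of a tower of type `b` reads the word `ζ^{[n]}(b)` and then arrives at the
bottom of the next tower (`towerPassage`). In the suspension the tower has height
`|ζ^{[n]}(b)|_s`. Up to two partial towers of level `n`, a piece of orbit of length `R` is therefore
a union of full towers, and the twisted integral over it is a sum of twisted integrals over towers,
which depend only on `n` and `b` as soon as `n` is at least the level of `f`.

Let `Φ_n(b)` be the twisted integral over a tower of level `n` and type `b`, and let `h_n(b)` be its
height. The estimate `|Φ_n(b)| ≤ ‖f‖ D_n h_n(b)`, where `D_n` is the damping product over `k < n`,
is propagated from level `n` to level `n + 1` (`exists_tower_bound`). The word `ζ_{n+1}(b)` has the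
form `ζ(u)`, and for a good return word `v` starting with `c` every `ζ(x)` contains `vc`. The two
towers of type `c` at the ends of `vc` together contribute at most
`|Φ_n(c)| |1 + exp(-2πiω|ζ^{[n]}(v)|_s)| ≤ ‖f‖ D_n h_n(c) (2 - 4 ‖ω|ζ^{[n]}(v)|_s‖²)`. Since the
heights `h_n` come from words of the form `ζ(u')`, they are comparable with a ratio depending only on
`Q` (`height_le_col_mul`), so that the gain is a definite proportion `c₁ ‖ω|ζ^{[n]}(v)|_s‖²` of the
height of each `ζ(x)`. Keeping the comparable vector `h_n` as the majorant, and not `|Φ_n|` itself,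
is what makes the step work.

Summing over the full towers gives `‖f‖ R D_n`, and the two partial towers contribute at most
`2 ‖f‖ max_b h_n(b)` (`norm_twistedIntegral_le`). For `n = ⌈log R / (4θ₁)⌉` the Lyapunov exponent of
the vector `(1, …, 1)`, which is at most `θ₁`, bounds the heights `h_n` by `R^{1/2}` when `n` is
large (`eventually_height_le`). Hence the constant `2`, and no loss `R^η`, in the final estimate.
-/

namespace RandomBV

/-! ### The successor of a path -/

section Combinatorics

variable {m : ℕ} {Γ : ℕ → OrdGraph m}

theorem edge_ext {Δ : OrdGraph m} {e e' : Δ.Edge} (h₁ : e.1 = e'.1)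
    (h₂ : (e.2 : ℕ) = (e'.2 : ℕ)) : e = e' := by
  obtain ⟨i, p⟩ := e
  obtain ⟨i', p'⟩ := e'
  obtain rfl : i = i' := h₁
  obtain rfl : p = p' := Fin.ext h₂
  rfl

/-- The edges of `e` at the levels below `n` are minimal: `e` stands at the bottom of a tower of
level `n`. -/
def MinBelow (n : ℕ) (e : PathSpace Γ) : Prop := ∀ k < n, ((e.1 k).2 : ℕ) = 0

/-- `e'` comes from `e` by replacing the edges at the levels `≥ n` by their successor in the
Vershik order and all the edges below the level of the change by minimal ones: `e'` is the bottom
of the tower of level `n` that follows the one containing `e`. -/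
def LevelSucc (n : ℕ) (e e' : PathSpace Γ) : Prop :=
  ∃ N, n ≤ N ∧ (∀ k, n ≤ k → k < N → OrdGraph.IsMaxEdge (e.1 k)) ∧
    (e'.1 N).1 = (e.1 N).1 ∧ ((e'.1 N).2 : ℕ) = (e.1 N).2 + 1 ∧
    (∀ k, N < k → e'.1 k = e.1 k) ∧ ∀ k < N, ((e'.1 k).2 : ℕ) = 0

theorem LevelSucc.minBelow {n : ℕ} {e e' : PathSpace Γ} (h : LevelSucc n e e') :
    MinBelow n e' := by
  obtain ⟨N, hN, -, -, -, -, h0⟩ := h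
  exact fun k hk => h0 k (hk.trans_le hN)

/-- The edge sequence which agrees with `g` from level `n` on and is continued below level `n` by
minimal edges. -/
def fillMin : (n : ℕ) → (∀ k, (Γ k).Edge) → ∀ k, (Γ k).Edge
  | 0, g => g
  | n + 1, g => fillMin n (Function.update g n
      ⟨OrdGraph.final (g (n + 1)), ⟨0, List.length_pos_of_ne_nil ((Γ n).out_ne_nil _)⟩⟩)

theorem fillMin_of_le {n k : ℕ} (hk : n ≤ k) (g : ∀ k, (Γ k).Edge) : fillMin n g k = g k := by
  induction n generalizing g with
  | zero => rfl
  | succ n ih =>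
    rw [fillMin, ih (by omega), Function.update_of_ne (by omega)]

theorem fillMin_index {n k : ℕ} (hk : k < n) (g : ∀ k, (Γ k).Edge) :
    ((fillMin n g k).2 : ℕ) = 0 := by
  induction n generalizing g with
  | zero => omega
  | succ n ih =>
    rw [fillMin]
    rcases Nat.lt_succ_iff_lt_or_eq.1 hk with h | rfl
    · exact ih h _
    · rw [fillMin_of_le le_rfl, Function.update_self]

theorem fillMin_compat {n k : ℕ} (hk : k < n) (g : ∀ k, (Γ k).Edge) :
    OrdGraph.final (fillMin n g (k + 1)) = OrdGraph.initial (fillMin n g k) := by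
  induction n generalizing g with
  | zero => omega
  | succ n ih =>
    rw [fillMin]
    rcases Nat.lt_succ_iff_lt_or_eq.1 hk with h | rfl
    · exact ih h _
    · rw [fillMin_of_le (Nat.le_succ _), fillMin_of_le le_rfl, Function.update_self,
        Function.update_of_ne (by omega)]
      rfl

theorem exists_levelSucc_zero {e : PathSpace Γ} (h : ¬ IsMaxPath e) :
    ∃ e', LevelSucc 0 e e' := by
  classical
  have hex : ∃ n, ¬ OrdGraph.IsMaxEdge (e.1 n) := not_forall.1 h
  obtain ⟨N, hN, hmin⟩ : ∃ N, ¬ OrdGraph.IsMaxEdge (e.1 N) ∧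
      ∀ k < N, OrdGraph.IsMaxEdge (e.1 k) :=
    ⟨Nat.find hex, Nat.find_spec hex, fun k hk => not_not.1 (Nat.find_min hex hk)⟩
  have hlt : ((e.1 N).2 : ℕ) + 1 < ((Γ N).out (e.1 N).1).length :=
    lt_of_le_of_ne (e.1 N).2.2 hN
  let g : ∀ k, (Γ k).Edge := Function.update e.1 N ⟨(e.1 N).1, ⟨_, hlt⟩⟩
  have hgN : g N = ⟨(e.1 N).1, ⟨_, hlt⟩⟩ := Function.update_self ..
  have hg : ∀ k, k ≠ N → g k = e.1 k := fun k hk => Function.update_of_ne hk ..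
  refine ⟨⟨fillMin N g, fun k => ?_⟩, N, Nat.zero_le _, fun k _ => hmin k, ?_, ?_, ?_, ?_⟩
  · rcases lt_or_ge k N with hk | hk
    · exact fillMin_compat hk g
    · rw [fillMin_of_le (by omega), fillMin_of_le hk, hg (k + 1) (by omega), e.2 k]
      rcases eq_or_ne k N with rfl | hkN
      · rw [hgN]; rfl
      · rw [hg k hkN]
  · change (fillMin N g N).1 = _
    rw [fillMin_of_le le_rfl, hgN]
  · change ((fillMin N g N).2 : ℕ) = _
    rw [fillMin_of_le le_rfl, hgN]
  · intro k hk
    change fillMin N g k = _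
    rw [fillMin_of_le hk.le, hg k (by omega)]
  · exact fun k hk => fillMin_index hk g

/-- Distinct paths that agree from some level on are comparable. -/
theorem pathLT_or_pathLT {d d' : PathSpace Γ} (hne : d ≠ d')
    (h : ∃ N, ∀ n, N < n → d.1 n = d'.1 n) : PathLT d d' ∨ PathLT d' d := by
  classical
  obtain ⟨N, hN⟩ := h
  have hex : ∃ n, n ≤ N ∧ d.1 n ≠ d'.1 n := by
    by_contra! hcon
    exact hne (Subtype.ext (funext fun n => (le_or_gt n N).elim (hcon n) (hN n)))
  -- the last level at which the two paths differ
  let M := Nat.findGreatest (fun n => d.1 n ≠ d'.1 n) N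
  obtain ⟨n₀, hn₀, hd₀⟩ := hex
  have hM : d.1 M ≠ d'.1 M := Nat.findGreatest_spec (P := fun n => d.1 n ≠ d'.1 n) hn₀ hd₀
  have habove : ∀ n, M < n → d.1 n = d'.1 n := by
    intro n hn
    rcases le_or_gt n N with h | h
    · exact not_not.1 (Nat.findGreatest_is_greatest hn h)
    · exact hN n h
  have hinit : (d.1 M).1 = (d'.1 M).1 := by
    have h₁ := d.2 M
    have h₂ := d'.2 M
    rw [habove (M + 1) (Nat.lt_succ_self _)] at h₁
    exact h₁.symm.trans h₂
  rcases lt_trichotomy ((d.1 M).2 : ℕ) ((d'.1 M).2 : ℕ) with hlt | heq | hgt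
  · exact Or.inl ⟨M, ⟨hinit, hlt⟩, habove⟩
  · exact absurd (edge_ext hinit heq) hM
  · exact Or.inr ⟨M, ⟨hinit.symm, hgt⟩, fun n hn => (habove n hn).symm⟩

theorem LevelSucc.isSuccPath {e e' : PathSpace Γ} (h : LevelSucc 0 e e') : IsSuccPath e e' := by
  obtain ⟨N, -, hmax, hi, hidx, habove, hmin⟩ := h
  refine ⟨⟨N, ⟨hi.symm, by omega⟩, fun n hn => (habove n hn).symm⟩, ?_⟩
  rintro d ⟨⟨M, ⟨hM₁, hM₂⟩, hM⟩, ⟨M', ⟨hM'₁, hM'₂⟩, hM'⟩⟩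
  rcases lt_trichotomy M N with hMN | rfl | hMN
  · have h₁ := hmax M (Nat.zero_le _) hMN
    have h₂ := (d.1 M).2.2
    have h₃ := congrArg (fun i => ((Γ M).out i).length) hM₁
    rw [OrdGraph.IsMaxEdge] at h₁
    omega
  · rcases lt_trichotomy M' M with h' | rfl | h'
    · have := hmin M' h'
      omega
    · omega
    · rw [habove M' h', hM M' h'] at hM'₂
      exact lt_irrefl _ hM'₂
  · rcases lt_trichotomy M' M with h' | rfl | h'
    · have h₁ := hM' M h'
      rw [habove M hMN] at h₁
      rw [h₁] at hM₂
      exact lt_irrefl _ hM₂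
    · rw [habove M' hMN] at hM'₂
      omega
    · rw [habove M' (hMN.trans h'), hM M' h'] at hM'₂
      exact lt_irrefl _ hM'₂

theorem IsSuccPath.unique {e d d' : PathSpace Γ} (h : IsSuccPath e d) (h' : IsSuccPath e d') :
    d = d' := by
  by_contra hne
  obtain ⟨⟨N, hN, hNa⟩, h2⟩ := h
  obtain ⟨⟨N', hN', hNa'⟩, h2'⟩ := h'
  rcases pathLT_or_pathLT hne ⟨max N N', fun n hn =>
    (hNa n (lt_of_le_of_lt (le_max_left _ _) hn)).symm.trans
      (hNa' n (lt_of_le_of_lt (le_max_right _ _) hn))⟩ with hlt | hlt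
  · exact h2' d ⟨⟨N, hN, hNa⟩, hlt⟩
  · exact h2 d' ⟨⟨N', hN', hNa'⟩, hlt⟩

theorem levelSucc_bvMap {e : PathSpace Γ} (h : ¬ IsMaxPath e) : LevelSucc 0 e (bvMap e) := by
  obtain ⟨e', he'⟩ := exists_levelSucc_zero h
  have hex : ∃ e', IsSuccPath e e' := ⟨e', he'.isSuccPath⟩
  have : bvMap e = e' := by
    rw [bvMap, dif_pos hex]
    exact hex.choose_spec.unique he'.isSuccPath
  rwa [this]

theorem HasForwardOrbit.iterate {e : PathSpace Γ} (h : HasForwardOrbit e) (n : ℕ) :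
    HasForwardOrbit (bvMap^[n] e) := by
  intro k
  rw [← Function.iterate_add_apply]
  exact h _

/-! ### Words, tiling lengths and return times -/

@[simp] theorem iterSubst_nil (n : ℕ) : iterSubst Γ n [] = [] := by
  induction n with
  | zero => rfl
  | succ n ih => exact ih

theorem iterSubst_append (n : ℕ) (v w : List (Fin m)) :
    iterSubst Γ n (v ++ w) = iterSubst Γ n v ++ iterSubst Γ n w := by
  induction n generalizing v w with
  | zero => rfl
  | succ n ih => simp [iterSubst, applySubst, ih]

theorem iterSubst_cons (n : ℕ) (b : Fin m) (w : List (Fin m)) :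
    iterSubst Γ n (b :: w) = iterSubst Γ n [b] ++ iterSubst Γ n w :=
  iterSubst_append n [b] w

theorem iterSubst_succ_singleton (n : ℕ) (b : Fin m) :
    iterSubst Γ (n + 1) [b] = iterSubst Γ n ((Γ n).out b) := by
  simp [iterSubst, applySubst, OrdGraph.subst]

@[simp] theorem tilingLength_nil (s : Fin m → ℝ) : tilingLength s [] = 0 := by
  simp [tilingLength, population]

theorem tilingLength_append (s : Fin m → ℝ) (v w : List (Fin m)) :
    tilingLength s (v ++ w) = tilingLength s v + tilingLength s w := by
  simp [tilingLength, population, add_mul, Finset.sum_add_distrib]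

theorem tilingLength_singleton (s : Fin m → ℝ) (b : Fin m) : tilingLength s [b] = s b := by
  simp [tilingLength, population, List.count_singleton]

theorem tilingLength_nonneg {s : Fin m → ℝ} (hs : ∀ i, 0 ≤ s i) (w : List (Fin m)) :
    0 ≤ tilingLength s w :=
  Finset.sum_nonneg fun j _ => mul_nonneg (Nat.cast_nonneg _) (hs j)

theorem returnTime_zero (s : Fin m → ℝ) (e : PathSpace Γ) : returnTime s e 0 = 0 := by
  simp [returnTime]

theorem returnTime_add (s : Fin m → ℝ) (e : PathSpace Γ) (N M : ℕ) :
    returnTime s e (N + M) = returnTime s e N + returnTime s (bvMap^[N] e) M := by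
  rw [returnTime, Finset.sum_range_add]
  congr 1
  refine Finset.sum_congr rfl fun j _ => ?_
  rw [← Function.iterate_add_apply, add_comm]

/-! ### The orbit inside a tower -/

/-- The height, in number of steps, of the tower of level `n` at whose bottom `e` stands. -/
def towerCard (n : ℕ) (e : PathSpace Γ) : ℕ :=
  (iterSubst Γ n [OrdGraph.final (e.1 n)]).length

/-- The part, from `e` on, of the tower of level `n + 1` containing `e`, written as a word in the
towers of level `n`. -/
def remainingWord (n : ℕ) (e : PathSpace Γ) : List (Fin m) :=
  ((Γ n).out (e.1 n).1).drop (e.1 n).2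

theorem remainingWord_eq (n : ℕ) (e : PathSpace Γ) :
    remainingWord n e =
      OrdGraph.final (e.1 n) :: ((Γ n).out (e.1 n).1).drop ((e.1 n).2 + 1) := by
  rw [remainingWord, List.drop_eq_getElem_cons (e.1 n).2.2]
  rfl

/-- The description of the orbit of the bottom `e` of a tower of level `n`, for all such `e`. -/
structure TowerPassage (Γ : ℕ → OrdGraph m) (s : Fin m → ℝ) (n : ℕ) : Prop where
  succ : ∀ e : PathSpace Γ, HasForwardOrbit e → MinBelow n e →
    LevelSucc n e (bvMap^[towerCard n e] e)
  time : ∀ e : PathSpace Γ, HasForwardOrbit e → MinBelow n e →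
    returnTime s e (towerCard n e) = tilingLength s (iterSubst Γ n [OrdGraph.final (e.1 n)])
  fixed : ∀ e : PathSpace Γ, HasForwardOrbit e → MinBelow n e →
    ∀ j < towerCard n e, ∀ k, n ≤ k → (bvMap^[j] e).1 k = e.1 k
  sync : ∀ e e' : PathSpace Γ, HasForwardOrbit e → MinBelow n e → HasForwardOrbit e' →
    MinBelow n e' → OrdGraph.final (e.1 n) = OrdGraph.final (e'.1 n) →
    ∀ j < towerCard n e, ∀ k < n, (bvMap^[j] e).1 k = (bvMap^[j] e').1 k

theorem LevelSucc.succ_of_isMaxEdge {n : ℕ} {e e' : PathSpace Γ} (h : LevelSucc n e e')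
    (hmax : OrdGraph.IsMaxEdge (e.1 n)) : LevelSucc (n + 1) e e' := by
  obtain ⟨N, hN, hm, hi, hidx, ha, h0⟩ := h
  refine ⟨N, ?_, fun k hk => hm k (by omega), hi, hidx, ha, h0⟩
  rcases hN.eq_or_lt with rfl | hlt
  · have h₁ := (e'.1 n).2.2
    have h₂ := congrArg (fun i => ((Γ n).out i).length) hi
    rw [OrdGraph.IsMaxEdge] at hmax
    omega
  · exact hlt

theorem LevelSucc.of_not_isMaxEdge {n : ℕ} {e e' : PathSpace Γ} (h : LevelSucc n e e')
    (hmax : ¬ OrdGraph.IsMaxEdge (e.1 n)) :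
    (e'.1 n).1 = (e.1 n).1 ∧ ((e'.1 n).2 : ℕ) = (e.1 n).2 + 1 ∧
      ∀ k, n < k → e'.1 k = e.1 k := by
  obtain ⟨N, hN, hm, hi, hidx, ha, h0⟩ := h
  rcases hN.eq_or_lt with rfl | hlt
  · exact ⟨hi, hidx, ha⟩
  · exact absurd (hm n le_rfl hlt) hmax

theorem LevelSucc.congr_left {n : ℕ} {e d e' : PathSpace Γ} (h : LevelSucc n e e')
    (hd : ∀ k, n ≤ k → e.1 k = d.1 k) : LevelSucc n d e' := by
  obtain ⟨N, hN, hm, hi, hidx, ha, h0⟩ := h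
  refine ⟨N, hN, fun k hk hk' => hd k hk ▸ hm k hk hk', hd N hN ▸ hi, hd N hN ▸ hidx,
    fun k hk => (ha k hk).trans (hd k (hN.trans hk.le)), h0⟩

/-- The remaining word shrinks by one letter when the orbit passes from a tower of level `n` to
the next one inside the same tower of level `n + 1`. -/
theorem remainingWord_next {n : ℕ} {e e' : PathSpace Γ} {c : Fin m} {w : List (Fin m)}
    (hw : remainingWord n e = c :: w) (hi : (e'.1 n).1 = (e.1 n).1)
    (hidx : ((e'.1 n).2 : ℕ) = (e.1 n).2 + 1) : remainingWord n e' = w := by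
  rw [remainingWord_eq, List.cons.injEq] at hw
  have h := congrArg (fun i => ((Γ n).out i).drop ((e.1 n).2 + 1)) hi
  rw [remainingWord, hidx]
  exact h.trans hw.2

theorem isMaxEdge_iff_remainingWord {n : ℕ} {e : PathSpace Γ} {c : Fin m} {w : List (Fin m)}
    (hw : remainingWord n e = c :: w) : OrdGraph.IsMaxEdge (e.1 n) ↔ w = [] := by
  have h := congrArg List.length hw
  rw [remainingWord, List.length_drop, List.length_cons] at h
  have hlt := (e.1 n).2.2
  rw [OrdGraph.IsMaxEdge, ← List.length_eq_zero_iff]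
  omega

theorem final_eq_of_remainingWord {n : ℕ} {e : PathSpace Γ} {c : Fin m} {w : List (Fin m)}
    (hw : remainingWord n e = c :: w) : OrdGraph.final (e.1 n) = c := by
  rw [remainingWord_eq, List.cons.injEq] at hw
  exact hw.1

/-- The orbit of the bottom `e` of a tower of level `n` up to the end of the tower of level
`n + 1` which contains it. -/
theorem TowerPassage.column {s : Fin m → ℝ} {n : ℕ} (H : TowerPassage Γ s n)
    (w : List (Fin m)) (e e' : PathSpace Γ) (he : HasForwardOrbit e) (hm : MinBelow n e)
    (he' : HasForwardOrbit e') (hm' : MinBelow n e') (hn : e.1 n = e'.1 n)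
    (hw : remainingWord n e = w) :
    LevelSucc (n + 1) e (bvMap^[(iterSubst Γ n w).length] e) ∧
    returnTime s e (iterSubst Γ n w).length = tilingLength s (iterSubst Γ n w) ∧
    (∀ j < (iterSubst Γ n w).length, ∀ k, n + 1 ≤ k → (bvMap^[j] e).1 k = e.1 k) ∧
    ∀ j < (iterSubst Γ n w).length, ∀ k < n + 1, (bvMap^[j] e).1 k = (bvMap^[j] e').1 k := by
  induction w generalizing e e' with
  | nil => rw [remainingWord_eq] at hw; simp at hw
  | cons c w ih =>
    have hc := final_eq_of_remainingWord hw
    have hc' : OrdGraph.final (e'.1 n) = c := hn ▸ hc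
    have hcard : towerCard n e = (iterSubst Γ n [c]).length := by rw [towerCard, hc]
    have hcard' : towerCard n e' = (iterSubst Γ n [c]).length := by rw [towerCard, hc']
    have hS := H.succ e he hm
    have hS' := H.succ e' he' hm'
    have hT := H.time e he hm
    have hF := H.fixed e he hm
    have hF' := H.fixed e' he' hm'
    have hY := H.sync e e' he hm he' hm' (hc.trans hc'.symm)
    rw [hcard] at hS hT hF hY
    rw [hcard'] at hS' hF'
    rw [hc] at hT
    have hY1 : ∀ j < (iterSubst Γ n [c]).length, ∀ k < n + 1,
        (bvMap^[j] e).1 k = (bvMap^[j] e').1 k := by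
      intro j hj k hk
      rcases Nat.lt_succ_iff_lt_or_eq.1 hk with hk | rfl
      · exact hY j hj k hk
      · rw [hF j hj k le_rfl, hF' j hj k le_rfl, hn]
    by_cases hmax : OrdGraph.IsMaxEdge (e.1 n)
    · obtain rfl := (isMaxEdge_iff_remainingWord hw).1 hmax
      exact ⟨hS.succ_of_isMaxEdge hmax, hT, fun j hj k hk => hF j hj k (by omega), hY1⟩
    · have hmax' : ¬ OrdGraph.IsMaxEdge (e'.1 n) := hn ▸ hmax
      obtain ⟨hi, hidx, ha⟩ := hS.of_not_isMaxEdge hmax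
      obtain ⟨hi', hidx', -⟩ := hS'.of_not_isMaxEdge hmax'
      set L := (iterSubst Γ n [c]).length with hL
      obtain ⟨h1, h2, h3, h4⟩ := ih (bvMap^[L] e) (bvMap^[L] e') (he.iterate _) hS.minBelow
        (he'.iterate _) hS'.minBelow
        (edge_ext (by rw [hi, hi', hn]) (by rw [hidx, hidx', hn])) (remainingWord_next hw hi hidx)
      have hlen : (iterSubst Γ n (c :: w)).length = L + (iterSubst Γ n w).length := by
        rw [iterSubst_cons, List.length_append]
      rw [hlen]
      have hsplit : ∀ j, L ≤ j → ∀ d : PathSpace Γ,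
          bvMap^[j] d = bvMap^[j - L] (bvMap^[L] d) := by
        intro j hj d
        rw [← Function.iterate_add_apply, Nat.sub_add_cancel hj]
      refine ⟨?_, ?_, ?_, ?_⟩
      · rw [Nat.add_comm _ (iterSubst Γ n w).length, Function.iterate_add_apply]
        exact h1.congr_left fun k hk => ha k hk
      · rw [returnTime_add, h2, hT, iterSubst_cons n c w, tilingLength_append]
      · intro j hj k hk
        rcases lt_or_ge j L with hjL | hjL
        · exact hF j hjL k (by omega)
        · rw [hsplit j hjL, h3 _ (by omega) k hk, ha k hk]
      · intro j hj k hk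
        rcases lt_or_ge j L with hjL | hjL
        · exact hY1 j hjL k hk
        · rw [hsplit j hjL, hsplit j hjL, h4 _ (by omega) k hk]

theorem MinBelow.remainingWord_eq_out {n : ℕ} {e : PathSpace Γ} (h : MinBelow (n + 1) e) :
    remainingWord n e = (Γ n).out (OrdGraph.final (e.1 (n + 1))) := by
  rw [remainingWord, h n (Nat.lt_succ_self n), List.drop_zero, e.2 n]
  rfl

theorem MinBelow.mono {n k : ℕ} {e : PathSpace Γ} (h : MinBelow n e) (hk : k ≤ n) :
    MinBelow k e := fun j hj => h j (hj.trans_le hk)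

theorem towerPassage (Γ : ℕ → OrdGraph m) (s : Fin m → ℝ) (n : ℕ) : TowerPassage Γ s n := by
  induction n with
  | zero =>
    have hcard : ∀ e : PathSpace Γ, towerCard 0 e = 1 := fun e => rfl
    refine ⟨fun e he _ => ?_, fun e he _ => ?_, fun e he _ j hj k _ => ?_,
      fun _ _ _ _ _ _ _ _ _ k hk => absurd hk (Nat.not_lt_zero k)⟩
    · rw [hcard]
      exact levelSucc_bvMap (he 0)
    · rw [hcard, iterSubst, tilingLength_singleton]
      simp [returnTime, roof, PathSpace.vertexZero]
    · rw [hcard, Nat.lt_one_iff] at hj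
      rw [hj]
      rfl
  | succ n H =>
    have hcard : ∀ e : PathSpace Γ, MinBelow (n + 1) e →
        towerCard (n + 1) e = (iterSubst Γ n (remainingWord n e)).length := fun e hm => by
      rw [towerCard, iterSubst_succ_singleton, hm.remainingWord_eq_out]
    have hcol := fun (e : PathSpace Γ) (he : HasForwardOrbit e) (hm : MinBelow (n + 1) e) =>
      H.column _ e e he (hm.mono n.le_succ) he (hm.mono n.le_succ) rfl rfl
    refine ⟨fun e he hm => ?_, fun e he hm => ?_, fun e he hm => ?_,
      fun e e' he hm he' hm' hf => ?_⟩
    · rw [hcard e hm]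
      exact (hcol e he hm).1
    · rw [hcard e hm, (hcol e he hm).2.1, iterSubst_succ_singleton, hm.remainingWord_eq_out]
    · rw [hcard e hm]
      exact (hcol e he hm).2.2.1
    · rw [hcard e hm]
      refine (H.column _ e e' he (hm.mono n.le_succ) he' (hm'.mono n.le_succ) ?_ rfl).2.2.2
      refine edge_ext ?_ ?_
      · exact (e.2 n).symm.trans (hf.trans (e'.2 n))
      · rw [hm n n.lt_succ_self, hm' n n.lt_succ_self]

/-- Every forward orbit reaches the bottom of a tower of level `n` within the height of the tower
containing its starting point. -/
theorem exists_enter {s : Fin m → ℝ} (hs : ∀ i, 0 ≤ s i) (n : ℕ) (e : PathSpace Γ)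
    (he : HasForwardOrbit e) :
    ∃ N, 0 < N ∧ LevelSucc n e (bvMap^[N] e) ∧
      returnTime s e N ≤ tilingLength s (iterSubst Γ n [OrdGraph.final (e.1 n)]) := by
  induction n with
  | zero =>
    refine ⟨1, one_pos, levelSucc_bvMap (he 0), ?_⟩
    rw [iterSubst, tilingLength_singleton]
    simp [returnTime, roof, PathSpace.vertexZero]
  | succ n ih =>
    obtain ⟨N, hN, hS, hT⟩ := ih
    have hw := remainingWord_eq n e
    set c := OrdGraph.final (e.1 n)
    set w := ((Γ n).out (e.1 n).1).drop ((e.1 n).2 + 1)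
    have hle : tilingLength s (iterSubst Γ n (c :: w)) ≤
        tilingLength s (iterSubst Γ (n + 1) [OrdGraph.final (e.1 (n + 1))]) := by
      rw [iterSubst_succ_singleton, e.2 n, OrdGraph.initial,
        ← List.take_append_drop (e.1 n).2 ((Γ n).out (e.1 n).1), iterSubst_append,
        tilingLength_append, ← hw, remainingWord]
      exact le_add_of_nonneg_left (tilingLength_nonneg hs _)
    rw [iterSubst_cons, tilingLength_append] at hle
    have hw0 := tilingLength_nonneg hs (iterSubst Γ n w)
    by_cases hmax : OrdGraph.IsMaxEdge (e.1 n)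
    · exact ⟨N, hN, hS.succ_of_isMaxEdge hmax, by linarith⟩
    · obtain ⟨hi, hidx, ha⟩ := hS.of_not_isMaxEdge hmax
      have he1 := he.iterate N
      obtain ⟨h1, h2, -, -⟩ := (towerPassage Γ s n).column w _ _ he1 hS.minBelow he1 hS.minBelow
        rfl (remainingWord_next hw hi hidx)
      refine ⟨N + (iterSubst Γ n w).length, by omega, ?_, ?_⟩
      · rw [Nat.add_comm _ (iterSubst Γ n w).length, Function.iterate_add_apply]
        exact h1.congr_left fun k hk => ha k hk
      · rw [returnTime_add, h2]
        linarith

end Combinatorics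

/-! ### Twisted sums over words -/

section Words

variable {m : ℕ}

/-- The character `x ↦ e^{-2πiωx}`. -/
noncomputable def twist (ω x : ℝ) : ℂ := Complex.exp (-2 * Real.pi * Complex.I * ω * x)

theorem twist_eq (ω x : ℝ) :
    twist ω x = Complex.exp (((-2 * Real.pi * ω * x : ℝ) : ℂ) * Complex.I) := by
  rw [twist]
  congr 1
  push_cast
  ring

theorem norm_twist (ω x : ℝ) : ‖twist ω x‖ = 1 := by
  rw [twist_eq, Complex.norm_exp_ofReal_mul_I]

theorem twist_add (ω x y : ℝ) : twist ω (x + y) = twist ω x * twist ω y := by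
  rw [twist, twist, twist, ← Complex.exp_add]
  congr 1
  push_cast
  ring

theorem twist_zero (ω : ℝ) : twist ω 0 = 1 := by simp [twist]

theorem continuous_twist (ω : ℝ) : Continuous (twist ω) := by
  unfold twist
  fun_prop

theorem distInt_nonneg (x : ℝ) : 0 ≤ distInt x := abs_nonneg _

theorem distInt_le_half (x : ℝ) : distInt x ≤ 1 / 2 := abs_sub_round x

theorem norm_one_add_twist_le (ω x : ℝ) : ‖1 + twist ω x‖ ≤ 2 - 4 * distInt (ω * x) ^ 2 := by
  set y := ω * x
  have h1 : 1 + twist ω x =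
      Complex.exp (((-(Real.pi * y) : ℝ) : ℂ) * Complex.I) *
        ((2 * Real.cos (Real.pi * y) : ℝ) : ℂ) := by
    rw [twist_eq]
    push_cast
    rw [Complex.two_cos, mul_add, ← Complex.exp_add, ← Complex.exp_add]
    rw [← Complex.exp_zero]
    congr 2
    · ring
    · simp only [y]; push_cast; ring
  rw [h1, norm_mul, Complex.norm_exp_ofReal_mul_I, one_mul, Complex.norm_real, Real.norm_eq_abs,
    abs_mul, abs_two]
  have h2 : |Real.cos (Real.pi * y)| = |Real.cos (Real.pi * distInt y)| := by
    have : Real.pi * (y - round y) = Real.pi * y - (round y : ℤ) * Real.pi := by ring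
    rw [distInt]
    rcases abs_choice (y - round y) with h | h <;> rw [h]
    · rw [this, Real.cos_sub_int_mul_pi, abs_mul, abs_zpow, abs_neg, abs_one, one_zpow, one_mul]
    · rw [mul_neg, Real.cos_neg, this, Real.cos_sub_int_mul_pi, abs_mul, abs_zpow, abs_neg,
        abs_one, one_zpow, one_mul]
  have hd0 := distInt_nonneg y
  have hd := distInt_le_half y
  have hpi := Real.pi_pos
  have h3 : 0 ≤ Real.cos (Real.pi * distInt y) :=
    Real.cos_nonneg_of_mem_Icc ⟨by nlinarith, by nlinarith⟩
  rw [h2, abs_of_nonneg h3]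
  have h5 : Real.cos (Real.pi * distInt y) ≤ 1 - 2 / Real.pi ^ 2 * (Real.pi * distInt y) ^ 2 :=
    Real.cos_le_one_sub_mul_cos_sq (by rw [abs_of_nonneg (by positivity)]; nlinarith)
  have h6 : 2 / Real.pi ^ 2 * (Real.pi * distInt y) ^ 2 = 2 * distInt y ^ 2 := by
    field_simp
  linarith

/-- The twisted sum over a word `w` whose letters `b` have lengths `h b` and weights `ψ b`: each
occurrence of `b` is twisted by the length of the word preceding it. -/
noncomputable def twistedWord (ω : ℝ) (h : Fin m → ℝ) (ψ : Fin m → ℂ) : List (Fin m) → ℂ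
  | [] => 0
  | b :: w => ψ b + twist ω (h b) * twistedWord ω h ψ w

theorem tilingLength_cons (h : Fin m → ℝ) (b : Fin m) (w : List (Fin m)) :
    tilingLength h (b :: w) = h b + tilingLength h w := by
  rw [← List.singleton_append, tilingLength_append, tilingLength_singleton]

theorem twistedWord_append (ω : ℝ) (h : Fin m → ℝ) (ψ : Fin m → ℂ) (v w : List (Fin m)) :
    twistedWord ω h ψ (v ++ w) =
      twistedWord ω h ψ v + twist ω (tilingLength h v) * twistedWord ω h ψ w := by
  induction v with
  | nil => simp [twistedWord, twist_zero]
  | cons b v ih =>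
    rw [List.cons_append, twistedWord, twistedWord, ih, tilingLength_cons, twist_add]
    ring

theorem norm_add_twist_mul_le {ω x : ℝ} {z w : ℂ} {a b : ℝ} (hz : ‖z‖ ≤ a) (hw : ‖w‖ ≤ b) :
    ‖z + twist ω x * w‖ ≤ a + b :=
  (norm_add_le _ _).trans (add_le_add hz (by rwa [norm_mul, norm_twist, one_mul]))

variable {ω : ℝ} {h : Fin m → ℝ} {ψ : Fin m → ℂ} {D : ℝ}

theorem norm_twistedWord_le (hψ : ∀ b, ‖ψ b‖ ≤ D * h b) (w : List (Fin m)) :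
    ‖twistedWord ω h ψ w‖ ≤ D * tilingLength h w := by
  induction w with
  | nil => simp [twistedWord]
  | cons b w ih =>
    rw [twistedWord, tilingLength_cons, mul_add]
    exact norm_add_twist_mul_le (hψ b) ih

/-- The two occurrences of `c` at the ends of `vc` interfere. -/
theorem norm_twistedWord_le_of_infix (hψ : ∀ b, ‖ψ b‖ ≤ D * h b) {v w : List (Fin m)} {c : Fin m}
    (hv : v.head? = some c) (hw : (v ++ [c]) <:+: w) :
    ‖twistedWord ω h ψ w‖ ≤
      D * (tilingLength h w - 4 * distInt (ω * tilingLength h v) ^ 2 * h c) := by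
  obtain ⟨x, y, rfl⟩ := hw
  obtain ⟨v', rfl⟩ : ∃ v', v = c :: v' := by
    cases v with
    | nil => simp at hv
    | cons b v' => exact ⟨v', by simpa using hv⟩
  set d := distInt (ω * tilingLength h (c :: v'))
  have hkey : ‖twistedWord ω h ψ ((c :: v') ++ [c])‖ ≤
      D * (tilingLength h ((c :: v') ++ [c]) - 4 * d ^ 2 * h c) := by
    have h1 : twistedWord ω h ψ ((c :: v') ++ [c]) =
        (1 + twist ω (tilingLength h (c :: v'))) * ψ c +
          twist ω (h c) * twistedWord ω h ψ v' := by
      rw [twistedWord_append]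
      simp only [twistedWord]
      ring
    have h2 : ‖(1 + twist ω (tilingLength h (c :: v'))) * ψ c‖ ≤
        (2 - 4 * d ^ 2) * (D * h c) := by
      rw [norm_mul]
      exact mul_le_mul (norm_one_add_twist_le _ _) (hψ c) (norm_nonneg _)
        ((norm_nonneg _).trans (norm_one_add_twist_le _ _))
    rw [h1, tilingLength_append, tilingLength_singleton]
    refine (norm_add_twist_mul_le h2 (norm_twistedWord_le hψ v')).trans_eq ?_
    rw [tilingLength_cons]
    ring
  rw [List.append_assoc x, twistedWord_append, tilingLength_append, twistedWord_append,
    tilingLength_append h _ y]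
  have hx := norm_twistedWord_le (ω := ω) hψ x
  have hy := norm_twistedWord_le (ω := ω) hψ y
  refine (norm_add_twist_mul_le hx (norm_add_twist_mul_le hkey hy)).trans_eq ?_
  ring

theorem tilingLength_le_card_mul {B K : ℝ} (hK : ∀ i j, h i ≤ K * h j) (hh : ∀ i, 0 ≤ h i)
    {w : List (Fin m)} (hB : ∀ j, (w.count j : ℝ) ≤ B) (c : Fin m) :
    tilingLength h w ≤ m * B * K * h c := by
  calc tilingLength h w ≤ ∑ _j : Fin m, B * (K * h c) :=
        Finset.sum_le_sum fun j _ => mul_le_mul (hB j) (hK j c) (hh j)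
          ((Nat.cast_nonneg _).trans (hB j))
    _ = m * B * K * h c := by
        rw [Finset.sum_const, Finset.card_univ, Fintype.card_fin, nsmul_eq_mul]
        ring

/-- A good return word for `ζ` forces cancellation in the twisted sum over every word `ζ(u)`: each
letter of `u` contributes one pair of interfering letters, of a length comparable to that of the
image of the letter. -/
theorem norm_twistedWord_applySubst_le {ζ : Fin m → List (Fin m)} {v : List (Fin m)} {B K : ℝ}
    (hψ : ∀ b, ‖ψ b‖ ≤ D * h b) (hD : 0 ≤ D) (hh : ∀ i, 0 ≤ h i)
    (hK : ∀ i j, h i ≤ K * h j) (hB : ∀ j b, ((ζ b).count j : ℝ) ≤ B)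
    (hBK : 0 < m * B * K) (hv : IsGoodReturnWord ζ v) (u : List (Fin m)) :
    ‖twistedWord ω h ψ (applySubst ζ u)‖ ≤
      D * ((1 - (2 * m * B * K)⁻¹ * distInt (ω * tilingLength h v) ^ 2) *
        tilingLength h (applySubst ζ u)) := by
  obtain ⟨c, hc, hinf⟩ := hv
  induction u with
  | nil => simp [applySubst, twistedWord]
  | cons b u ih =>
    have hcons : applySubst ζ (b :: u) = ζ b ++ applySubst ζ u := rfl
    rw [hcons, twistedWord_append, tilingLength_append, mul_add, mul_add]
    refine norm_add_twist_mul_le ?_ ih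
    refine (norm_twistedWord_le_of_infix hψ hc (hinf b)).trans
      (mul_le_mul_of_nonneg_left ?_ hD)
    have h1 := tilingLength_le_card_mul hK hh (hB · b) c
    have h2 : (2 * m * B * K)⁻¹ * tilingLength h (ζ b) ≤ h c := by
      rw [inv_mul_le_iff₀ (by linarith)]
      have := mul_nonneg hBK.le (hh c)
      linarith
    have h3 := mul_le_mul_of_nonneg_left h2 (sq_nonneg (distInt (ω * tilingLength h v)))
    have h4 := mul_nonneg (sq_nonneg (distInt (ω * tilingLength h v))) (hh c)
    linarith

end Words

/-! ### Heights of the towers -/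

section Heights

variable {m : ℕ} {Γ : ℕ → OrdGraph m}

/-- The heights of the towers of level `n` in the suspension. -/
noncomputable def height (Γ : ℕ → OrdGraph m) (s : Fin m → ℝ) (n : ℕ) (b : Fin m) : ℝ :=
  tilingLength s (iterSubst Γ n [b])

theorem tilingLength_iterSubst (s : Fin m → ℝ) (n : ℕ) (w : List (Fin m)) :
    tilingLength s (iterSubst Γ n w) = tilingLength (height Γ s n) w := by
  induction w with
  | nil => simp
  | cons b w ih => rw [iterSubst_cons, tilingLength_append, tilingLength_cons, ih, height]

theorem height_succ (s : Fin m → ℝ) (n : ℕ) (b : Fin m) :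
    height Γ s (n + 1) b = tilingLength (height Γ s n) ((Γ n).out b) := by
  rw [height, iterSubst_succ_singleton, tilingLength_iterSubst]

theorem height_zero (s : Fin m → ℝ) (b : Fin m) : height Γ s 0 b = s b := by
  rw [height, iterSubst, tilingLength_singleton]

theorem height_nonneg {s : Fin m → ℝ} (hs : ∀ i, 0 ≤ s i) (n : ℕ) (b : Fin m) :
    0 ≤ height Γ s n b := tilingLength_nonneg hs _

theorem height_pos {s : Fin m → ℝ} (hs : ∀ i, 0 < s i) (n : ℕ) (b : Fin m) :
    0 < height Γ s n b := by
  induction n generalizing b with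
  | zero => rw [height_zero]; exact hs b
  | succ n ih =>
    obtain ⟨c, w, hc⟩ := List.exists_cons_of_ne_nil ((Γ n).out_ne_nil b)
    rw [height_succ, hc, tilingLength_cons]
    exact add_pos_of_pos_of_nonneg (ih c) (tilingLength_nonneg (fun i => (ih i).le) _)

theorem height_mono {s s' : Fin m → ℝ} (hs : ∀ i, s i ≤ s' i) (n : ℕ) (b : Fin m) :
    height Γ s n b ≤ height Γ s' n b := by
  unfold height tilingLength
  exact Finset.sum_le_sum fun j _ => mul_le_mul_of_nonneg_left (hs j) (Nat.cast_nonneg _)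

theorem le_maxEntry (Q : Matrix (Fin m) (Fin m) ℕ) (i j : Fin m) : (Q i j : ℝ) ≤ maxEntry Q :=
  le_ciSup (f := fun x : Fin m × Fin m => (Q x.1 x.2 : ℝ)) (Set.finite_range _).bddAbove (i, j)

theorem div_le_col (A : Matrix (Fin m) (Fin m) ℕ) (i j k : Fin m) :
    (A i j : ℝ) / (A k j : ℝ) ≤ col A :=
  le_ciSup (f := fun x : Fin m × Fin m × Fin m => (A x.1 x.2.1 : ℝ) / (A x.2.2 x.2.1 : ℝ))
    (Set.finite_range _).bddAbove (i, j, k)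

/-- Towers of level `n + 1` have comparable heights, because the words `ζ_{n+1}(b)` are images of
the words `ζ_q(b)`, in which all letters have comparable frequencies. -/
theorem height_le_col_mul {q p : OrdGraph m} {s : Fin m → ℝ} (hs : ∀ i, 0 ≤ s i) {n : ℕ}
    (hΓ : Γ n = p.concat q) (hq : ∀ i j, 0 < q.substMatrix i j) (i j : Fin m) :
    height Γ s (n + 1) i ≤ col q.substMatrixᵀ * height Γ s (n + 1) j := by
  have hform : ∀ b, height Γ s (n + 1) b =
      ∑ c, (q.substMatrix c b : ℝ) * tilingLength (height Γ s n) (p.subst c) := by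
    intro b
    rw [height_succ, hΓ]
    change tilingLength _ (applySubst p.subst (q.out b)) = tilingLength _ (q.out b)
    generalize q.out b = w
    induction w with
    | nil => simp [applySubst]
    | cons c w ih =>
      rw [tilingLength_cons, ← ih, ← tilingLength_append]
      rfl
  rw [hform, hform, Finset.mul_sum]
  refine Finset.sum_le_sum fun c _ => ?_
  rw [← mul_assoc]
  refine mul_le_mul_of_nonneg_right ?_ (tilingLength_nonneg (height_nonneg hs n) _)
  have h := div_le_col q.substMatrixᵀ i c j
  simp only [Matrix.transpose_apply] at h
  rwa [div_le_iff₀ (by exact_mod_cast hq c j)] at h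

end Heights

/-! ### Damping of the twisted sums over towers -/

section Damping

variable {m : ℕ} {Γ : ℕ → OrdGraph m}

theorem maxReturnDist_nonneg (ζ : Fin m → List (Fin m)) (Γ : ℕ → OrdGraph m) (s : Fin m → ℝ)
    (ω : ℝ) (k : ℕ) : 0 ≤ maxReturnDist ζ Γ s ω k :=
  Real.iSup_nonneg fun _ => sq_nonneg _

theorem maxReturnDist_le (ζ : Fin m → List (Fin m)) (Γ : ℕ → OrdGraph m) (s : Fin m → ℝ)
    (ω : ℝ) (k : ℕ) : maxReturnDist ζ Γ s ω k ≤ 1 := by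
  refine Real.iSup_le (fun v => ?_) zero_le_one
  have h0 := distInt_nonneg (ω * tilingLength s (iterSubst Γ k v))
  have h1 := distInt_le_half (ω * tilingLength s (iterSubst Γ k v))
  nlinarith

theorem one_le_maxEntry {Q : Matrix (Fin m) (Fin m) ℕ} (hQ : ∀ i j, 0 < Q i j) (i : Fin m) :
    1 ≤ maxEntry Q :=
  le_trans (by exact_mod_cast hQ i i) (le_maxEntry Q i i)

theorem one_le_col {Q : Matrix (Fin m) (Fin m) ℕ} (hQ : ∀ i j, 0 < Q i j) (i : Fin m) :
    1 ≤ col Qᵀ := by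
  have h := div_le_col Qᵀ i i i
  rwa [div_self (by simpa using (hQ i i).ne')] at h

theorem one_le_mul_maxEntry_mul_col {Q : Matrix (Fin m) (Fin m) ℕ} (hQ : ∀ i j, 0 < Q i j)
    (i : Fin m) : 1 ≤ m * maxEntry Q * col Qᵀ := by
  have hm : (1 : ℝ) ≤ m := by exact_mod_cast i.pos
  exact one_le_mul_of_one_le_of_one_le
    (one_le_mul_of_one_le_of_one_le hm (one_le_maxEntry hQ i)) (one_le_col hQ i)

theorem damping_factor_nonneg {q : OrdGraph m} (hq : ∀ i j, 0 < q.substMatrix i j) (i : Fin m)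
    (Γ : ℕ → OrdGraph m) (s : Fin m → ℝ) (ω : ℝ) (k : ℕ) :
    0 ≤ 1 - c₁ q.substMatrix * maxReturnDist q.subst Γ s ω k := by
  have h := one_le_mul_maxEntry_mul_col hq i
  have hc : c₁ q.substMatrix ≤ 1 := inv_le_one_of_one_le₀ (by linarith)
  have := mul_le_one₀ hc (maxReturnDist_nonneg q.subst Γ s ω k) (maxReturnDist_le q.subst Γ s ω k)
  linarith

/-- The twisted Birkhoff sum of `φ` over the first `N` points of the orbit of `e`, the twist being
by the return times. -/
noncomputable def twistedSum (ω : ℝ) (s : Fin m → ℝ) (φ : PathSpace Γ → ℂ) (e : PathSpace Γ)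
    (N : ℕ) : ℂ :=
  ∑ j ∈ Finset.range N, twist ω (returnTime s e j) * φ (bvMap^[j] e)

theorem twistedSum_add (ω : ℝ) (s : Fin m → ℝ) (φ : PathSpace Γ → ℂ) (e : PathSpace Γ)
    (N M : ℕ) : twistedSum ω s φ e (N + M) = twistedSum ω s φ e N +
      twist ω (returnTime s e N) * twistedSum ω s φ (bvMap^[N] e) M := by
  rw [twistedSum, Finset.sum_range_add, twistedSum, twistedSum, Finset.mul_sum]
  congr 1
  refine Finset.sum_congr rfl fun j _ => ?_
  rw [returnTime_add, twist_add, ← Function.iterate_add_apply, add_comm j N, mul_assoc]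

theorem norm_twistedSum_le {ω S : ℝ} {s : Fin m → ℝ} {φ : PathSpace Γ → ℂ}
    (hφ : ∀ e, ‖φ e‖ ≤ S * roof s e) (e : PathSpace Γ) (N : ℕ) :
    ‖twistedSum ω s φ e N‖ ≤ S * returnTime s e N := by
  rw [returnTime, Finset.mul_sum]
  refine norm_sum_le_of_le _ fun j _ => ?_
  rw [norm_mul, norm_twist, one_mul]
  exact hφ _

/-- The twisted sum over the rest of a tower of level `n + 1` is the twisted sum over the word
spelled by the towers of level `n` in it. -/
theorem twistedSum_remainingWord {ω : ℝ} {s : Fin m → ℝ} {φ : PathSpace Γ → ℂ} {n : ℕ}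
    {ψ : Fin m → ℂ} (hψ : ∀ e : PathSpace Γ, HasForwardOrbit e → MinBelow n e →
      twistedSum ω s φ e (towerCard n e) = ψ (OrdGraph.final (e.1 n)))
    (w : List (Fin m)) (e : PathSpace Γ) (he : HasForwardOrbit e) (hm : MinBelow n e)
    (hw : remainingWord n e = w) :
    twistedSum ω s φ e (iterSubst Γ n w).length = twistedWord ω (height Γ s n) ψ w := by
  induction w generalizing e with
  | nil => rw [remainingWord_eq] at hw; simp at hw
  | cons c w ih =>
    have hc := final_eq_of_remainingWord hw
    have hcard : towerCard n e = (iterSubst Γ n [c]).length := by rw [towerCard, hc]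
    have hS := (towerPassage Γ s n).succ e he hm
    have hT := (towerPassage Γ s n).time e he hm
    have hE := hψ e he hm
    rw [hcard] at hS hT hE
    rw [hc] at hT hE
    rw [iterSubst_cons, List.length_append, twistedSum_add, hE, hT, twistedWord]
    congr 2
    by_cases hmax : OrdGraph.IsMaxEdge (e.1 n)
    · obtain rfl := (isMaxEdge_iff_remainingWord hw).1 hmax
      simp [twistedSum, twistedWord]
    · obtain ⟨hi, hidx, -⟩ := hS.of_not_isMaxEdge hmax
      exact ih _ (he.iterate _) hS.minBelow (remainingWord_next hw hi hidx)

/-- The twisted sums over the towers of level `n ≥ ℓ` depend only on the type of the tower when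
`φ` depends only on the first `ℓ` edges. -/
theorem twistedSum_towerCard_congr {ω : ℝ} {s : Fin m → ℝ} {φ : PathSpace Γ → ℂ} {ℓ n : ℕ}
    (hφ : ∀ e e' : PathSpace Γ, (∀ k < ℓ, e.1 k = e'.1 k) → φ e = φ e') (hℓ : 1 ≤ ℓ) (hn : ℓ ≤ n)
    {e e' : PathSpace Γ} (he : HasForwardOrbit e) (hm : MinBelow n e) (he' : HasForwardOrbit e')
    (hm' : MinBelow n e') (hf : OrdGraph.final (e.1 n) = OrdGraph.final (e'.1 n)) :
    twistedSum ω s φ e (towerCard n e) = twistedSum ω s φ e' (towerCard n e') := by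
  have hsync := (towerPassage Γ s n).sync e e' he hm he' hm' hf
  have hcard : towerCard n e' = towerCard n e := by rw [towerCard, towerCard, hf]
  rw [twistedSum, twistedSum, hcard]
  refine Finset.sum_congr rfl fun j hj => ?_
  rw [Finset.mem_range] at hj
  congr 1
  · congr 1
    refine Finset.sum_congr rfl fun i hi => ?_
    rw [Finset.mem_range] at hi
    rw [roof, roof, PathSpace.vertexZero, PathSpace.vertexZero,
      hsync i (hi.trans hj) 0 (by omega)]
  · exact hφ _ _ fun k hk => hsync j hj k (by omega)

/-- The twisted sums over towers are damped, from one level to the next, by the factors of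
`dampingProduct`. -/
theorem exists_tower_bound {q : OrdGraph m} (hq : ∀ i j, 0 < q.substMatrix i j)
    (hΓ : ∀ n, ∃ p : OrdGraph m, Γ n = (q.concat p).concat q) {ω S : ℝ} (hS : 0 ≤ S)
    {s : Fin m → ℝ} (hs : ∀ i, 0 ≤ s i) {φ : PathSpace Γ → ℂ} {ℓ : ℕ} (hℓ : 1 ≤ ℓ)
    (hφ : ∀ e e' : PathSpace Γ, (∀ k < ℓ, e.1 k = e'.1 k) → φ e = φ e')
    (hφS : ∀ e, ‖φ e‖ ≤ S * roof s e) {n : ℕ} (hn : ℓ + 1 ≤ n) :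
    ∃ ψ : Fin m → ℂ, (∀ e : PathSpace Γ, HasForwardOrbit e → MinBelow n e →
      twistedSum ω s φ e (towerCard n e) = ψ (OrdGraph.final (e.1 n))) ∧
      ∀ b, ‖ψ b‖ ≤ S * (∏ k ∈ Finset.Ico (ℓ + 1) n,
        (1 - c₁ q.substMatrix * maxReturnDist q.subst Γ s ω k)) * height Γ s n b := by
  classical
  induction n, hn using Nat.le_induction with
  | base =>
    refine ⟨fun b => if h : ∃ e : PathSpace Γ, HasForwardOrbit e ∧ MinBelow (ℓ + 1) e ∧
        OrdGraph.final (e.1 (ℓ + 1)) = b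
        then twistedSum ω s φ h.choose (towerCard (ℓ + 1) h.choose) else 0,
      fun e he hm => ?_, fun b => ?_⟩
    · have h : ∃ d : PathSpace Γ, HasForwardOrbit d ∧ MinBelow (ℓ + 1) d ∧
          OrdGraph.final (d.1 (ℓ + 1)) = OrdGraph.final (e.1 (ℓ + 1)) := ⟨e, he, hm, rfl⟩
      beta_reduce
      rw [dif_pos h]
      obtain ⟨h1, h2, h3⟩ := h.choose_spec
      exact twistedSum_towerCard_congr hφ hℓ (Nat.le_succ _) he hm h1 h2 h3.symm
    · rw [Finset.Ico_self, Finset.prod_empty, mul_one]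
      beta_reduce
      split_ifs with h
      · obtain ⟨h1, h2, h3⟩ := h.choose_spec
        refine (norm_twistedSum_le hφS _ _).trans_eq ?_
        rw [(towerPassage Γ s (ℓ + 1)).time _ h1 h2, h3, height]
      · rw [norm_zero]
        exact mul_nonneg hS (height_nonneg hs _ _)
  | succ n hn ih =>
    obtain ⟨ψ, hψ, hψb⟩ := ih
    refine ⟨fun b => twistedWord ω (height Γ s n) ψ ((Γ n).out b), fun e he hm => ?_,
      fun b => ?_⟩
    · beta_reduce
      rw [← hm.remainingWord_eq_out, ← twistedSum_remainingWord hψ _ e he (hm.mono n.le_succ) rfl,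
        hm.remainingWord_eq_out, ← iterSubst_succ_singleton, towerCard]
    · obtain ⟨p, hp⟩ := hΓ n
      obtain ⟨n', rfl⟩ : ∃ n', n = n' + 1 := ⟨n - 1, by omega⟩
      obtain ⟨p', hp'⟩ := hΓ n'
      set D := S * ∏ k ∈ Finset.Ico (ℓ + 1) (n' + 1),
        (1 - c₁ q.substMatrix * maxReturnDist q.subst Γ s ω k) with hDdef
      have hD : 0 ≤ D := mul_nonneg hS
        (Finset.prod_nonneg fun k _ => damping_factor_nonneg hq b Γ s ω k)
      have hout : (Γ (n' + 1)).out b = applySubst q.subst (applySubst p.subst (q.subst b)) := by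
        rw [hp]
        change List.flatMap _ _ = _
        simp only [applySubst, OrdGraph.subst, OrdGraph.concat, List.flatMap_assoc]
      have hH := height_nonneg (Γ := Γ) hs (n' + 1 + 1) b
      have hstep : ∀ v, IsGoodReturnWord q.subst v →
          ‖twistedWord ω (height Γ s (n' + 1)) ψ ((Γ (n' + 1)).out b)‖ ≤
            D * ((1 - c₁ q.substMatrix *
              distInt (ω * tilingLength s (iterSubst Γ (n' + 1) v)) ^ 2) *
                height Γ s (n' + 1 + 1) b) := by
        intro v hv
        rw [height_succ, hout, tilingLength_iterSubst]
        exact norm_twistedWord_applySubst_le hψb hD (height_nonneg hs _)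
          (height_le_col_mul hs hp' hq) (fun j b => le_maxEntry q.substMatrix j b)
          (lt_of_lt_of_le one_pos (one_le_mul_maxEntry_mul_col hq b)) hv _
      have htriv := norm_twistedWord_le (ω := ω) hψb ((Γ (n' + 1)).out b)
      rw [← height_succ] at htriv
      rw [Finset.prod_Ico_succ_top hn, ← mul_assoc, ← hDdef, mul_assoc]
      set X := ‖twistedWord ω (height Γ s (n' + 1)) ψ ((Γ (n' + 1)).out b)‖
      set H := height Γ s (n' + 1 + 1) b
      have hc : 0 ≤ c₁ q.substMatrix := inv_nonneg.2 (by
        have := one_le_mul_maxEntry_mul_col hq b; linarith)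
      -- `hstep` bounds each term of the supremum; dividing by the coefficient needs it positive
      rcases (mul_nonneg (mul_nonneg hD hc) hH).eq_or_lt with h0 | h0
      · calc X ≤ D * H := htriv
          _ = D * H - (D * c₁ q.substMatrix * H) *
              maxReturnDist q.subst Γ s ω (n' + 1) := by rw [← h0]; ring
          _ = _ := by ring
      · have hsup : maxReturnDist q.subst Γ s ω (n' + 1) ≤
            (D * H - X) / (D * c₁ q.substMatrix * H) := by
          refine Real.iSup_le (fun v => ?_) (div_nonneg (by linarith) h0.le)
          rw [le_div_iff₀ h0]
          linarith [hstep v v.2]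
        rw [le_div_iff₀ h0] at hsup
        linarith

/-- From the bottom of a tower of level `n`, the twisted sums over whole towers of level `n` fill
any given length up to the height of one tower. -/
theorem exists_towers_filling {ω D h₀ h₁ : ℝ} {s : Fin m → ℝ} {φ : PathSpace Γ → ℂ} {n : ℕ}
    (hD : ∀ e : PathSpace Γ, HasForwardOrbit e → MinBelow n e →
      ‖twistedSum ω s φ e (towerCard n e)‖ ≤ D * height Γ s n (OrdGraph.final (e.1 n)))
    (h₀pos : 0 < h₀) (hh₀ : ∀ b, h₀ ≤ height Γ s n b) (hh₁ : ∀ b, height Γ s n b ≤ h₁)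
    {e : PathSpace Γ} (he : HasForwardOrbit e) (hm : MinBelow n e) {r : ℝ} (hr : 0 ≤ r) :
    ∃ N, returnTime s e N ≤ r ∧ r - returnTime s e N ≤ h₁ ∧
      ‖twistedSum ω s φ e N‖ ≤ D * returnTime s e N := by
  obtain ⟨K, hK⟩ : ∃ K : ℕ, r ≤ K * h₀ := by
    obtain ⟨K, hK⟩ := exists_nat_ge (r / h₀)
    exact ⟨K, (div_le_iff₀ h₀pos).1 hK⟩
  induction K generalizing e r with
  | zero =>
    refine ⟨0, by rwa [returnTime_zero], ?_, by simp [twistedSum, returnTime_zero]⟩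
    have := hh₀ (OrdGraph.final (e.1 n))
    have := hh₁ (OrdGraph.final (e.1 n))
    rw [Nat.cast_zero, zero_mul] at hK
    rw [returnTime_zero]
    linarith
  | succ K ih =>
    have hT := (towerPassage Γ s n).time e he hm
    have hE := hD e he hm
    have h₂ := hh₀ (OrdGraph.final (e.1 n))
    have h₃ := hh₁ (OrdGraph.final (e.1 n))
    rw [← height] at hT
    set H := height Γ s n (OrdGraph.final (e.1 n))
    rcases lt_or_ge r H with hlt | hge
    · refine ⟨0, by rwa [returnTime_zero], ?_, by simp [twistedSum, returnTime_zero]⟩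
      rw [returnTime_zero]
      linarith
    · push_cast at hK
      obtain ⟨N, hN₁, hN₂, hN₃⟩ := ih (he.iterate (towerCard n e))
        ((towerPassage Γ s n).succ e he hm).minBelow (r := r - H) (by linarith) (by linarith)
      refine ⟨towerCard n e + N, ?_, ?_, ?_⟩
      · rw [returnTime_add, hT]; linarith
      · rw [returnTime_add, hT]; linarith
      · rw [returnTime_add, twistedSum_add, hT, mul_add]
        exact norm_add_twist_mul_le hE hN₃

end Damping

/-! ### Twisted integrals along the suspension flow -/

section Flow

variable {m : ℕ} {Γ : ℕ → OrdGraph m} {s : Fin m → ℝ}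

theorem returnTime_succ (s : Fin m → ℝ) (e : PathSpace Γ) (n : ℕ) :
    returnTime s e (n + 1) = returnTime s e n + roof s (bvMap^[n] e) :=
  Finset.sum_range_succ _ _

theorem returnTime_strictMono (hs : ∀ i, 0 < s i) (e : PathSpace Γ) :
    StrictMono (returnTime s e) :=
  strictMono_nat_of_lt_succ fun n => by
    rw [returnTime_succ]
    exact lt_add_of_pos_right _ (hs _)

theorem exists_returnTime_gt (hs : ∀ i, 0 < s i) (e : PathSpace Γ) (u : ℝ) :
    ∃ n, u < returnTime s e n := by
  have : Nonempty (Fin m) := ⟨e.vertexZero⟩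
  obtain ⟨i₀, hi₀⟩ := Finite.exists_min s
  obtain ⟨n, hn⟩ := exists_nat_gt (u / s i₀)
  refine ⟨n, ((div_lt_iff₀ (hs i₀)).1 hn).trans_le ?_⟩
  rw [returnTime, ← nsmul_eq_mul]
  have := Finset.card_nsmul_le_sum (Finset.range n) (fun j => roof s (bvMap^[j] e)) (s i₀)
    fun j _ => hi₀ _
  rwa [Finset.card_range] at this

theorem returnCount_eq (hs : ∀ i, 0 < s i) (e : PathSpace Γ) {u : ℝ} {j : ℕ}
    (h₁ : returnTime s e j ≤ u) (h₂ : u < returnTime s e (j + 1)) : returnCount s e u = j := by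
  refine le_antisymm (Nat.sInf_le h₂) (le_csInf ⟨j, h₂⟩ fun n hn => ?_)
  have := (returnTime_strictMono hs e).lt_iff_lt.1 (h₁.trans_lt hn)
  omega

theorem flow_eq (hs : ∀ i, 0 < s i) (e : PathSpace Γ) {u : ℝ} {j : ℕ}
    (h₁ : returnTime s e j ≤ u) (h₂ : u < returnTime s e (j + 1)) :
    flow s u (e, 0) = (bvMap^[j] e, u - returnTime s e j) := by
  simp only [flow, zero_add, returnCount_eq hs e h₁ h₂]

theorem flow_mem_suspension (hs : ∀ i, 0 < s i) (e : PathSpace Γ) {u : ℝ} (hu : 0 ≤ u) :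
    flow s u (e, 0) ∈ suspension Γ s := by
  classical
  have hex := exists_returnTime_gt hs e u
  obtain ⟨n, hn, hmin⟩ : ∃ n, u < returnTime s e n ∧ ∀ k < n, ¬ u < returnTime s e k :=
    ⟨Nat.find hex, Nat.find_spec hex, fun k hk => Nat.find_min hex hk⟩
  obtain _ | j := n
  · rw [returnTime_zero] at hn
    exact absurd hn hu.not_gt
  · have h₁ := not_lt.1 (hmin j (Nat.lt_succ_self j))
    rw [flow_eq hs e h₁ hn]
    rw [returnTime_succ] at hn
    exact ⟨sub_nonneg.2 h₁, by simp only; linarith⟩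

theorem norm_le_supNorm {f : PathSpace Γ × ℝ → ℂ} (hf : IsBoundedOn s f) {p : PathSpace Γ × ℝ}
    (hp : p ∈ suspension Γ s) : ‖f p‖ ≤ supNorm s f := by
  obtain ⟨K, hK⟩ := hf
  exact le_ciSup (f := fun p : suspension Γ s => ‖f p‖)
    ⟨K, by rintro _ ⟨q, rfl⟩; exact hK q q.2⟩ ⟨p, hp⟩

theorem supNorm_nonneg (f : PathSpace Γ × ℝ → ℂ) : 0 ≤ supNorm s f :=
  Real.iSup_nonneg fun _ => norm_nonneg _

/-- The twisted integral of `f` over the fibre of the suspension above `e`. -/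
noncomputable def fibreIntegral (ω : ℝ) (s : Fin m → ℝ) (f : PathSpace Γ × ℝ → ℂ)
    (e : PathSpace Γ) : ℂ :=
  ∫ u in (0 : ℝ)..roof s e, twist ω u * f (e, u)

theorem fibreIntegral_congr {f : PathSpace Γ × ℝ → ℂ} {ℓ : ℕ} (hf : IsCylindrical s ℓ f)
    (hℓ : 1 ≤ ℓ) (hs : ∀ i, 0 < s i) (ω : ℝ) {e e' : PathSpace Γ}
    (h : ∀ k < ℓ, e.1 k = e'.1 k) : fibreIntegral ω s f e = fibreIntegral ω s f e' := by
  have hroof : roof s e = roof s e' := by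
    rw [roof, roof, PathSpace.vertexZero, PathSpace.vertexZero, h 0 hℓ]
  rw [fibreIntegral, fibreIntegral, ← hroof]
  refine intervalIntegral.integral_congr_ae ?_
  filter_upwards [Measure.ae_ne volume (roof s e)] with u hu hmem
  rw [Set.uIoc_of_le (show 0 ≤ roof s e from (hs _).le)] at hmem
  have hlt := lt_of_le_of_ne hmem.2 hu
  rw [hf.depends e e' u ⟨hmem.1.le, hlt⟩ ⟨hmem.1.le, hroof ▸ hlt⟩ h]

theorem norm_fibreIntegral_le {f : PathSpace Γ × ℝ → ℂ} (hf : IsBoundedOn s f)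
    (hs : ∀ i, 0 < s i) (ω : ℝ) (e : PathSpace Γ) :
    ‖fibreIntegral ω s f e‖ ≤ supNorm s f * roof s e := by
  have hroof : 0 ≤ roof s e := (hs _).le
  have h : ∀ᵐ u : ℝ, u ∈ Set.uIoc 0 (roof s e) → ‖twist ω u * f (e, u)‖ ≤ supNorm s f := by
    filter_upwards [Measure.ae_ne volume (roof s e)] with u hu hmem
    rw [Set.uIoc_of_le hroof] at hmem
    rw [norm_mul, norm_twist, one_mul]
    exact norm_le_supNorm hf ⟨hmem.1.le, lt_of_le_of_ne hmem.2 hu⟩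
  have := intervalIntegral.norm_integral_le_of_norm_le_const_ae h
  rwa [sub_zero, abs_of_nonneg hroof] at this

theorem intervalIntegrable_fibre {f : PathSpace Γ × ℝ → ℂ} {ℓ : ℕ} (hf : IsCylindrical s ℓ f)
    (hb : IsBoundedOn s f) (hs : ∀ i, 0 < s i) (ω : ℝ) (e : PathSpace Γ) :
    IntervalIntegrable (fun u => twist ω u * f (e, u)) volume 0 (roof s e) := by
  rw [intervalIntegrable_iff_integrableOn_Ico_of_le (show 0 ≤ roof s e from (hs _).le)]
  refine Integrable.of_bound ((continuous_twist ω).aestronglyMeasurable.mul (hf.measurable e))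
    (supNorm s f) ?_
  refine (ae_restrict_iff' measurableSet_Ico).2 (ae_of_all _ fun u hu => ?_)
  rw [norm_mul, norm_twist, one_mul]
  exact norm_le_supNorm hb hu

/-- The integrand of the twisted integral along the orbit of `(e, 0)`. -/
noncomputable def orbitIntegrand (ω : ℝ) (s : Fin m → ℝ) (f : PathSpace Γ × ℝ → ℂ)
    (e : PathSpace Γ) (u : ℝ) : ℂ :=
  twist ω u * f (flow s u (e, 0))

theorem norm_orbitIntegrand_le {f : PathSpace Γ × ℝ → ℂ} (hb : IsBoundedOn s f)
    (hs : ∀ i, 0 < s i) (ω : ℝ) (e : PathSpace Γ) {u : ℝ} (hu : 0 ≤ u) :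
    ‖orbitIntegrand ω s f e u‖ ≤ supNorm s f := by
  rw [orbitIntegrand, norm_mul, norm_twist, one_mul]
  exact norm_le_supNorm hb (flow_mem_suspension hs e hu)

theorem norm_integral_orbitIntegrand_le {f : PathSpace Γ × ℝ → ℂ} (hb : IsBoundedOn s f)
    (hs : ∀ i, 0 < s i) (ω : ℝ) (e : PathSpace Γ) {a b : ℝ} (ha : 0 ≤ a) (hab : a ≤ b) :
    ‖∫ u in a..b, orbitIntegrand ω s f e u‖ ≤ supNorm s f * (b - a) := by
  have := intervalIntegral.norm_integral_le_of_norm_le_const (a := a) (b := b)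
    (f := orbitIntegrand ω s f e) (C := supNorm s f) fun u hu => by
      rw [Set.uIoc_of_le hab] at hu
      exact norm_orbitIntegrand_le hb hs ω e (ha.trans hu.1.le)
  rwa [abs_of_nonneg (sub_nonneg.2 hab)] at this

theorem orbitIntegrand_eq (hs : ∀ i, 0 < s i) (ω : ℝ) (f : PathSpace Γ × ℝ → ℂ)
    (e : PathSpace Γ) {u : ℝ} {j : ℕ} (h₁ : returnTime s e j ≤ u)
    (h₂ : u < returnTime s e (j + 1)) :
    orbitIntegrand ω s f e u = twist ω (returnTime s e j) *
      (twist ω (u - returnTime s e j) * f (bvMap^[j] e, u - returnTime s e j)) := by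
  rw [orbitIntegrand, flow_eq hs e h₁ h₂, ← mul_assoc, ← twist_add, add_sub_cancel]

theorem intervalIntegrable_orbitIntegrand_succ {f : PathSpace Γ × ℝ → ℂ} {ℓ : ℕ}
    (hf : IsCylindrical s ℓ f) (hb : IsBoundedOn s f) (hs : ∀ i, 0 < s i) (ω : ℝ)
    (e : PathSpace Γ) (j : ℕ) :
    IntervalIntegrable (orbitIntegrand ω s f e) volume (returnTime s e j)
      (returnTime s e (j + 1)) := by
  have hle := (returnTime_strictMono hs e (Nat.lt_succ_self j)).le
  have h := (((intervalIntegrable_fibre hf hb hs ω (bvMap^[j] e)).comp_sub_right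
    (returnTime s e j)).const_mul (twist ω (returnTime s e j)))
  rw [zero_add, add_comm, ← returnTime_succ,
    intervalIntegrable_iff_integrableOn_Ico_of_le hle] at h
  rw [intervalIntegrable_iff_integrableOn_Ico_of_le hle]
  exact h.congr_fun (fun u hu => (orbitIntegrand_eq hs ω f e hu.1 hu.2).symm) measurableSet_Ico

theorem integral_orbitIntegrand_succ (hs : ∀ i, 0 < s i) (ω : ℝ) (f : PathSpace Γ × ℝ → ℂ)
    (e : PathSpace Γ) (j : ℕ) :
    ∫ u in returnTime s e j..returnTime s e (j + 1), orbitIntegrand ω s f e u =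
      twist ω (returnTime s e j) * fibreIntegral ω s f (bvMap^[j] e) := by
  have hle := (returnTime_strictMono hs e (Nat.lt_succ_self j)).le
  have h : ∫ u in returnTime s e j..returnTime s e (j + 1), orbitIntegrand ω s f e u =
      ∫ u in returnTime s e j..returnTime s e (j + 1), twist ω (returnTime s e j) *
        (twist ω (u - returnTime s e j) * f (bvMap^[j] e, u - returnTime s e j)) := by
    refine intervalIntegral.integral_congr_ae ?_
    filter_upwards [Measure.ae_ne volume (returnTime s e (j + 1))] with u hu hmem
    rw [Set.uIoc_of_le hle] at hmem
    exact orbitIntegrand_eq hs ω f e hmem.1.le (lt_of_le_of_ne hmem.2 hu)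
  rw [h, intervalIntegral.integral_const_mul,
    intervalIntegral.integral_comp_sub_right (fun u => twist ω u * f (bvMap^[j] e, u)),
    sub_self, returnTime_succ, add_sub_cancel_left, fibreIntegral]

theorem intervalIntegrable_orbitIntegrand {f : PathSpace Γ × ℝ → ℂ} {ℓ : ℕ}
    (hf : IsCylindrical s ℓ f) (hb : IsBoundedOn s f) (hs : ∀ i, 0 < s i) (ω : ℝ)
    (e : PathSpace Γ) {a b : ℝ} (ha : 0 ≤ a) (hab : a ≤ b) :
    IntervalIntegrable (orbitIntegrand ω s f e) volume a b := by
  obtain ⟨N, hN⟩ := exists_returnTime_gt hs e b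
  have h := IntervalIntegrable.trans_iterate (a := returnTime s e) (n := N)
    fun k _ => intervalIntegrable_orbitIntegrand_succ hf hb hs ω e k
  rw [returnTime_zero] at h
  refine h.mono_set ?_
  rw [Set.uIcc_of_le hab, Set.uIcc_of_le ((ha.trans hab).trans hN.le)]
  exact Set.Icc_subset_Icc ha hN.le

theorem integral_orbitIntegrand_returnTime {f : PathSpace Γ × ℝ → ℂ} {ℓ : ℕ}
    (hf : IsCylindrical s ℓ f) (hb : IsBoundedOn s f) (hs : ∀ i, 0 < s i) (ω : ℝ)
    (e : PathSpace Γ) (N : ℕ) :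
    ∫ u in (0 : ℝ)..returnTime s e N, orbitIntegrand ω s f e u =
      twistedSum ω s (fibreIntegral ω s f) e N := by
  rw [← returnTime_zero s e, ← intervalIntegral.sum_integral_adjacent_intervals
    fun k _ => intervalIntegrable_orbitIntegrand_succ hf hb hs ω e k, twistedSum]
  exact Finset.sum_congr rfl fun j _ => integral_orbitIntegrand_succ hs ω f e j

theorem norm_twistedIntegral_eq (s : Fin m → ℝ) (f : PathSpace Γ × ℝ → ℂ) (e : PathSpace Γ)
    (t ω R : ℝ) :
    ‖twistedIntegral s f (e, t) ω R‖ = ‖∫ u in t..t + R, orbitIntegrand ω s f e u‖ := by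
  have h : ∀ τ : ℝ, Complex.exp (-2 * Real.pi * Complex.I * ω * τ) * f (flow s τ (e, t)) =
      twist ω (-t) * orbitIntegrand ω s f e (t + τ) := by
    intro τ
    have hflow : flow s τ (e, t) = flow s (t + τ) (e, 0) := by simp only [flow, zero_add]
    rw [orbitIntegrand, ← mul_assoc, ← twist_add, hflow, neg_add_cancel_left, twist]
  rw [twistedIntegral]
  simp_rw [h]
  rw [intervalIntegral.integral_const_mul,
    intervalIntegral.integral_comp_add_left (orbitIntegrand ω s f e), norm_mul, norm_twist,
    one_mul, add_zero]

/-- The estimate of the twisted integrals in terms of the heights of the towers of a given level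
`n`: the orbit consists of full towers of level `n` and of two partial ones. -/
theorem norm_twistedIntegral_le {q : OrdGraph m} (hq : ∀ i j, 0 < q.substMatrix i j)
    (hΓ : ∀ n, ∃ p : OrdGraph m, Γ n = (q.concat p).concat q) (hs : ∀ i, 0 < s i)
    {f : PathSpace Γ × ℝ → ℂ} {ℓ : ℕ} (hℓ : 1 ≤ ℓ) (hf : IsCylindrical s ℓ f)
    (hb : IsBoundedOn s f) {e : PathSpace Γ} {t : ℝ} (he : HasForwardOrbit e)
    (ht : (e, t) ∈ suspension Γ s) (ω : ℝ) {R h₁ : ℝ} {n : ℕ} (hn : ℓ + 1 ≤ n)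
    (hh₁ : ∀ b, height Γ s n b ≤ h₁) (hR : h₁ ≤ R) :
    ‖twistedIntegral s f (e, t) ω R‖ ≤ supNorm s f * (2 * h₁ +
      R * ∏ k ∈ Finset.Ico (ℓ + 1) n,
        (1 - c₁ q.substMatrix * maxReturnDist q.subst Γ s ω k)) := by
  have hs0 : ∀ i, 0 ≤ s i := fun i => (hs i).le
  have hS : 0 ≤ supNorm s f := supNorm_nonneg f
  set D := ∏ k ∈ Finset.Ico (ℓ + 1) n,
    (1 - c₁ q.substMatrix * maxReturnDist q.subst Γ s ω k)
  have hD : 0 ≤ D := Finset.prod_nonneg fun k _ => damping_factor_nonneg hq e.vertexZero Γ s ω k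
  obtain ⟨ht0, htr⟩ := ht
  obtain ⟨ψ, hψ, hψb⟩ := exists_tower_bound hq hΓ (ω := ω) hS hs0 hℓ
    (fun _ _ => fibreIntegral_congr hf hℓ hs ω) (norm_fibreIntegral_le hb hs ω) hn
  have : Nonempty (Fin m) := ⟨e.vertexZero⟩
  obtain ⟨i₀, hi₀⟩ := Finite.exists_min (height Γ s n)
  -- the first arrival at the bottom of a tower of level `n`
  obtain ⟨N₀, hN₀, hsucc, htime⟩ := exists_enter hs0 n e he
  have ha₁ : returnTime s e N₀ ≤ h₁ := htime.trans (hh₁ _)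
  have hta : t ≤ returnTime s e N₀ := by
    refine htr.le.trans (le_trans (le_of_eq ?_) ((returnTime_strictMono hs e).monotone hN₀))
    simp [returnTime]
  -- the full towers that follow
  obtain ⟨N, hN₁, hN₂, hN₃⟩ := exists_towers_filling (ω := ω) (φ := fibreIntegral ω s f)
    (fun e he hm => (hψ e he hm).symm ▸ hψb _) (height_pos hs n i₀) hi₀ hh₁
    (he.iterate N₀) hsucc.minBelow (r := t + R - returnTime s e N₀) (by linarith)
  have hsplit := returnTime_add s e N₀ N
  have ha0 : 0 ≤ returnTime s e N₀ := ht0.trans hta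
  have hmid0 : returnTime s e N₀ ≤ returnTime s e (N₀ + N) :=
    (returnTime_strictMono hs e).monotone (Nat.le_add_right _ _)
  set a := returnTime s e N₀
  set b := returnTime s e (N₀ + N)
  have hbR : b ≤ t + R := by linarith
  have hint : ∀ {x y : ℝ}, 0 ≤ x → x ≤ y →
      IntervalIntegrable (orbitIntegrand ω s f e) volume x y :=
    intervalIntegrable_orbitIntegrand hf hb hs ω e
  have hmid : ∫ u in a..b, orbitIntegrand ω s f e u =
      twist ω a * twistedSum ω s (fibreIntegral ω s f) (bvMap^[N₀] e) N := by
    have h := intervalIntegral.integral_add_adjacent_intervals (hint le_rfl ha0) (hint ha0 hmid0)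
    rw [integral_orbitIntegrand_returnTime hf hb hs, integral_orbitIntegrand_returnTime hf hb hs,
      twistedSum_add] at h
    exact add_left_cancel h
  have hmid_le : ‖∫ u in a..b, orbitIntegrand ω s f e u‖ ≤ supNorm s f * D * R := by
    rw [hmid, norm_mul, norm_twist, one_mul]
    exact hN₃.trans (mul_le_mul_of_nonneg_left (by linarith) (mul_nonneg hS hD))
  have h₂ := norm_integral_orbitIntegrand_le hb hs ω e ht0 hta
  have h₃ := norm_integral_orbitIntegrand_le hb hs ω e (ha0.trans hmid0) hbR
  rw [norm_twistedIntegral_eq, ← intervalIntegral.integral_add_adjacent_intervals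
    (hint ht0 (hta.trans hmid0)) (hint (ha0.trans hmid0) hbR),
    ← intervalIntegral.integral_add_adjacent_intervals (hint ht0 hta) (hint ha0 hmid0)]
  have h₄ : supNorm s f * (a - t) ≤ supNorm s f * h₁ :=
    mul_le_mul_of_nonneg_left (by linarith) hS
  have h₅ : supNorm s f * (t + R - b) ≤ supNorm s f * h₁ :=
    mul_le_mul_of_nonneg_left (by linarith) hS
  refine (norm_add_le _ _).trans ((add_le_add_left (norm_add_le _ _) _).trans ?_)
  linarith

end Flow

/-! ### Growth of the heights of the towers -/

section Growth

variable {m : ℕ}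

theorem height_one_eq_cocycle (a : ℤ → OrdGraph m) (n : ℕ) (b : Fin m) :
    height (future a) (fun _ => 1) n b = (cocycle a n *ᵥ fun _ => 1) b := by
  induction n generalizing b with
  | zero => rw [height_zero, cocycle, Matrix.one_mulVec]
  | succ n ih =>
    rw [height_succ, cocycle, ← Matrix.mulVec_mulVec, ← funext ih]
    rfl

/-- A bound on the Lyapunov exponent of a vector bounds the growth of its images. -/
theorem eventually_norm_cocycle_le {a : ℤ → OrdGraph m} {v : Fin m → ℝ} {θ θ' : ℝ}
    (h : lyapunovExponent a v ≤ (θ : EReal)) (hθ : θ < θ') :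
    ∀ᶠ n : ℕ in atTop, ‖WithLp.toLp 2 (cocycle a n *ᵥ v)‖ ≤ Real.exp (θ' * n) := by
  have hlt := eventually_lt_of_limsup_lt (h.trans_lt (EReal.coe_lt_coe_iff.2 hθ))
  filter_upwards [hlt, eventually_gt_atTop 0] with n hn hn0
  have hn0' : (0 : EReal) < ((n : ℝ) : EReal) := by exact_mod_cast hn0
  rw [EReal.div_lt_iff hn0' (EReal.coe_ne_top _), ← EReal.coe_mul,
    ← Real.log_exp (θ' * n), ← ENNReal.log_ofReal_of_pos (Real.exp_pos _),
    ENNReal.log_lt_log_iff, ← ofReal_norm, ENNReal.ofReal_lt_ofReal_iff (Real.exp_pos _)] at hn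
  exact hn.le

theorem eventually_height_le {a : ℤ → OrdGraph m} {θ θ' : ℝ}
    (h : ∀ v, lyapunovExponent a v ≤ (θ : EReal)) (hθ : θ < θ') :
    ∀ᶠ n : ℕ in atTop, ∀ s : Fin m → ℝ, (∀ i, s i ≤ 1) → ∀ b,
      height (future a) s n b ≤ Real.exp (θ' * n) := by
  filter_upwards [eventually_norm_cocycle_le (h fun _ => 1) hθ] with n hn s hs b
  refine (height_mono hs n b).trans ?_
  rw [height_one_eq_cocycle]
  exact (le_abs_self _).trans ((PiLp.norm_apply_le
    (WithLp.toLp 2 (cocycle a n *ᵥ fun _ => (1 : ℝ))) b).trans hn)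

end Growth

end RandomBV

open RandomBV
theorem proposition7p1 {m : ℕ} (Q : Matrix (Fin m) (Fin m) ℕ) :
    ∃ C : ℝ, 0 < C ∧
      ∀ (q : OrdGraph m), q.substMatrix = Q →
      ∀ (P : Measure (ℤ → OrdGraph m)) (θ₁ θ₂ : ℝ), Conditions q P θ₁ θ₂ →
      ∀ᵐ a ∂P, ∀ η : ℝ, 0 < η → η < 1 → ∃ ℓη : ℕ, ∀ ℓ : ℕ, ℓη ≤ ℓ →
      ∀ s : Fin m → ℝ, (∀ i, 0 < s i) → ∑ i, s i = 1 →
      ∀ f : PathSpace (future a) × ℝ → ℂ, IsCylindrical s ℓ f → IsBoundedOn s f →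
      ∀ (e : PathSpace (future a)) (t : ℝ), HasForwardOrbit e → (e, t) ∈ suspension (future a) s →
      ∀ ω R : ℝ, Real.exp (8 * θ₁ * ℓ) ≤ R →
        ‖twistedIntegral s f (e, t) ω R‖ ≤
          C * supNorm s f *
            (R ^ (1 / 2 : ℝ) +
              R ^ (1 + η) * dampingProduct q (future a) s ω ℓ (Real.log R / (4 * θ₁))) := by
  refine ⟨2, two_pos, ?_⟩
  rintro q rfl P θ₁ θ₂ hP
  have hθ : 0 < θ₁ := hP.exponents.2.1.trans hP.exponents.1
  filter_upwards [hP.form, hP.exponents.2.2] with a hform hexp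
  intro η hη _
  -- Any rate strictly between `θ₁` and `2 θ₁` would do.
  obtain ⟨n₀, hn₀⟩ := eventually_atTop.1
    (eventually_height_le hexp.1 (show θ₁ < 3 / 2 * θ₁ by linarith))
  refine ⟨max n₀ 2, fun ℓ hℓ s hs hsum f hf hb e t he ht ω R hR => ?_⟩
  have hℓ₀ : n₀ ≤ ℓ := (le_max_left _ _).trans hℓ
  have hℓ2 : 2 ≤ ℓ := (le_max_right _ _).trans hℓ
  have hR1 : 1 ≤ R := le_trans (Real.one_le_exp (by positivity)) hR
  have hR0 : 0 < R := one_pos.trans_le hR1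
  set n := ⌈Real.log R / (4 * θ₁)⌉₊ with hn
  have hlog : 8 * θ₁ * ℓ ≤ Real.log R := (Real.le_log_iff_exp_le hR0).2 hR
  have hnℓ : 2 * ℓ ≤ n := by
    have h : (2 * ℓ : ℝ) ≤ Real.log R / (4 * θ₁) := by
      rw [le_div_iff₀ (by positivity)]
      linarith
    exact_mod_cast h.trans (Nat.le_ceil _)
  have hn4 : (4 : ℝ) ≤ n := by exact_mod_cast (by omega : 4 ≤ n)
  have hnR : 4 * θ₁ * (n - 1) ≤ Real.log R := by
    have h := Nat.ceil_lt_add_one (show 0 ≤ Real.log R / (4 * θ₁) from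
      div_nonneg (Real.log_nonneg hR1) (by positivity))
    rw [← hn, ← sub_lt_iff_lt_add, lt_div_iff₀ (by positivity)] at h
    linarith
  -- `3n/2 ≤ 2(n - 1)`, so the towers of level `n` have height at most `R^{1/2}`.
  have hheight : ∀ b, height (future a) s n b ≤ R ^ (1 / 2 : ℝ) := by
    intro b
    refine (hn₀ n (by omega) s (fun i => ?_) b).trans ?_
    · rw [← hsum]
      exact Finset.single_le_sum (fun j _ => (hs j).le) (Finset.mem_univ i)
    · rw [Real.rpow_def_of_pos hR0]
      refine Real.exp_le_exp.2 ?_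
      have := mul_le_mul_of_nonneg_left hn4 hθ.le
      linarith
  have hmain := norm_twistedIntegral_le hP.pos
    (Γ := future a) (fun k => hform ((k : ℤ) + 1)) hs
    (by omega : 1 ≤ ℓ) hf hb he ht ω (by omega : ℓ + 1 ≤ n) hheight
    (Real.rpow_le_self_of_one_le hR1 (by norm_num))
  rw [dampingProduct, ← hn]
  set D := ∏ k ∈ Finset.Ico (ℓ + 1) n,
    (1 - c₁ q.substMatrix * maxReturnDist q.subst (future a) s ω k)
  have hD : 0 ≤ D := Finset.prod_nonneg fun k _ =>
    damping_factor_nonneg hP.pos e.vertexZero (future a) s ω k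
  have hRη : R ≤ R ^ (1 + η) := Real.self_le_rpow_of_one_le hR1 (by linarith)
  have hRD : R * D ≤ 2 * (R ^ (1 + η) * D) := by
    have := mul_le_mul_of_nonneg_right hRη hD
    have := mul_nonneg hR0.le hD
    linarith
  calc _ ≤ _ := hmain
    _ ≤ supNorm s f * (2 * (R ^ (1 / 2 : ℝ) + R ^ (1 + η) * D)) :=
      mul_le_mul_of_nonneg_left (by linarith) (supNorm_nonneg f)
    _ = _ := by ring
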